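/- Let $\mathcal B$ be a (strict) 2-category. Composition of 1-cells is written by juxtaposition, $T'T$ meaning "$T'$ after $T$". A monad on a 0-cell $X$ is a 1-cell $S:X\to X$ with 2-cells $\eta^S:1\Rightarrow S$, $\mu^S:S^2\Rightarrow S$ satisfying the unit and associativity laws. A monad morphism $(X,S)\to(X',S')$ is a 1-cell $T:X\to X'$ with a 2-cell $\tau:S'T\Rightarrow TS$ such that $$\tau\circ\eta^{S'}T=T\eta^S,\qquad \tau\circ\mu^{S'}T=T\mu^S\circ\tau S\circ S'\tau .$$ A monad transformation $(T,\tau)\Rightarrow(T',\tau')$ is a 2-cell $\alpha:T\Rightarrow T'$ with $\tau'\circ S'\alpha=\alpha S\circ\tau$. With 1-cell composition $(T',\tau')\circ(T,\tau)=(T'T,\;T'\tau\circ\tau'T)$, identity 1-cells $(1,1)$, and composition of 2-cells inherited from $\mathcal B$, these form a 2-category $\mathrm{Mnd}(\mathcal B)$. Put $\mathrm{Mnd}^1(\mathcal B)=\mathrm{Mnd}(\mathcal B)$ and $\mathrm{Mnd}^{n}(\mathcal B)=\mathrm{Mnd}(\mathrm{Mnd}^{n-1}(\mathcal B))$. A distributive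 law of a monad $S$ over a monad $T$ on $X$ is a 2-cell $\lambda:ST\Rightarrow TS$ with $$\lambda\circ\eta^ST=T\eta^S,\quad \lambda\circ\mu^ST=T\mu^S\circ\lambda S\circ S\lambda,\quad \lambda\circ S\eta^T=\eta^TS,\quad \lambda\circ S\mu^T=\mu^TS\circ T\lambda\circ\lambda T .$$ **Theorem.** Fix $n\ge 3$. The 2-category $\mathrm{Mnd}^n(\mathcal B)$ is given (up to the canonical isomorphism of 2-categories described below) as follows. * A 0-cell is a tuple $(X,\{S_i\}_{1\le i\le n},\{\lambda_{ij}\}_{1\le i<j\le n})$ where $X$ is a 0-cell of $\mathcal B$, each $S_i$ is a monad on $X$, each $\lambda_{ij}:S_iS_j\Rightarrow S_jS_i$ is a distributive law of $S_i$ over $S_j$, and for all $i<j<k$ the Yang–Baxter equation holds: $$\lambda_{jk}S_i\circ S_j\lambda_{ik}\circ\lambda_{ij}S_k=S_k\lambda_{ij}\circ\lambda_{ik}S_j\circ S_i\lambda_{jk}:\;S_iS_jS_k\Rightarrow S_kS_jS_i .$$ * A 1-cell $(X,\{S_i\},\{\lambda_{ij}\})\to(X',\{S'_i\},\{\lambda'_{ij}\})$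 is a tuple $(T,\{\tau_i\}_{1\le i\le n})$ where $T:X\to X'$ is a 1-cell of $\mathcal B$, each $\tau_i:S'_iT\Rightarrow TS_i$ is a 2-cell of $\mathcal B$ making $(T,\tau_i)$ a monad morphism $(X,S_i)\to(X',S'_i)$, and for all $i<j$ $$\tau_jS_i\circ S'_j\tau_i\circ\lambda'_{ij}T=T\lambda_{ij}\circ\tau_iS_j\circ S'_i\tau_j:\;S'_iS'_jT\Rightarrow TS_jS_i .$$ The identity 1-cell is $(1,\{1\})$, and the composite of $(T,\tau_i)$ followed by $(T',\tau'_i)$ is $(T'T,\;T'\tau_i\circ\tau'_iT)$. * A 2-cell $(T,\tau_i)\Rightarrow(T',\tau'_i)$ is a 2-cell $\alpha:T\Rightarrow T'$ of $\mathcal B$ such that $\tau'_i\circ S'_i\alpha=\alpha S_i\circ\tau_i$ for all $i$, i.e. $\alpha$ is a monad transformation $(T,\tau_i)\Rightarrow(T',\tau'_i)$ for every $i$. Composition of 2-cells is inherited from $\mathcal B$. That is, these data form a 2-category $\mathcal E_n$, and there is a 2-functor $\mathcal E_n\to\mathrm{Mnd}^n(\mathcal B)$ that is bijective on 0-cells,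 on 1-cells and on 2-cells. Under it $S_i$ and $\tau_i$ are the monad and the 2-cell adjoined at the $i$-th application of $\mathrm{Mnd}$: for each $i$ it carries the 2-functor $\mathrm{Mnd}^n(\mathcal B)\to\mathrm{Mnd}(\mathcal B)$ extracting the $i$-th monad to $(X,\{S_i\},\{\lambda_{ij}\})\mapsto(X,S_i)$, $(T,\{\tau_i\})\mapsto(T,\tau_i)$, $\alpha\mapsto\alpha$, and for each $i<j$ it carries the 2-functor $\mathrm{Mnd}^n(\mathcal B)\to\mathrm{Mnd}^2(\mathcal B)$ extracting the $i$-th and $j$-th monads with their distributive law to $(X,\{S_i\},\{\lambda_{ij}\})\mapsto((X,S_i),(S_j,\lambda_{ij}))$, $(T,\{\tau_i\})\mapsto((T,\tau_i),\tau_j)$, $\alpha\mapsto\alpha$. -/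

import Mathlib

open CategoryTheory Bicategory

attribute [local instance 2000] CategoryTheory.CategoryStruct.toQuiver
  CategoryTheory.Bicategory.homCategory

universe w v u w' v' u' w'' v'' u''

namespace FormalMonads

section Cells

variable {B : Type u} [Bicategory.{w, v} B]

/-- A monad on a 0-cell `X` of a 2-category.  Composition of 1-cells is written in
diagrammatic order, so `f ≫ g` is "`g` after `f`"; whiskerings are `f ◁ α` and `α ▷ g`. -/
structure MonadOn (X : B) where
  /-- the underlying 1-cell -/
  t : X ⟶ X
  /-- the unit `1 ⇒ t` -/
  η : 𝟙 X ⟶ t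
  /-- the multiplication `t² ⇒ t` -/
  μ : t ≫ t ⟶ t
  unit_right : (λ_ t).inv ≫ η ▷ t ≫ μ = 𝟙 t
  unit_left : (ρ_ t).inv ≫ t ◁ η ≫ μ = 𝟙 t
  assoc : (α_ t t t).hom ≫ t ◁ μ ≫ μ = μ ▷ t ≫ μ

/-- `(T, τ)` with `τ : S' T ⇒ T S` is a monad morphism `(X, S) ⟶ (X', S')`. -/
structure IsMonadMor {X X' : B} (S : MonadOn X) (S' : MonadOn X') (T : X ⟶ X')
    (τ : T ≫ S'.t ⟶ S.t ≫ T) : Prop where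
  unit : T ◁ S'.η ≫ τ = (ρ_ T).hom ≫ (λ_ T).inv ≫ S.η ▷ T
  mul : T ◁ S'.μ ≫ τ =
    (α_ T S'.t S'.t).inv ≫ τ ▷ S'.t ≫ (α_ S.t T S'.t).hom ≫ S.t ◁ τ ≫
      (α_ S.t S.t T).inv ≫ S.μ ▷ T

/-- `α : T ⇒ T'` is a monad transformation `(T, τ) ⇒ (T', τ')`. -/
def IsMonadTrans {X X' : B} {s : X ⟶ X} {s' : X' ⟶ X'} {T T' : X ⟶ X'}
    (τ : T ≫ s' ⟶ s ≫ T) (τ' : T' ≫ s' ⟶ s ≫ T') (α : T ⟶ T') : Prop :=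
  α ▷ s' ≫ τ' = τ ≫ s ◁ α

/-- `l : S T ⇒ T S` is a distributive law of the monad `S` over the monad `T`. -/
structure IsDistLaw {X : B} (S T : MonadOn X) (l : T.t ≫ S.t ⟶ S.t ≫ T.t) : Prop where
  unit_S : T.t ◁ S.η ≫ l = (ρ_ T.t).hom ≫ (λ_ T.t).inv ≫ S.η ▷ T.t
  mul_S : T.t ◁ S.μ ≫ l =
    (α_ T.t S.t S.t).inv ≫ l ▷ S.t ≫ (α_ S.t T.t S.t).hom ≫ S.t ◁ l ≫
      (α_ S.t S.t T.t).inv ≫ S.μ ▷ T.t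
  unit_T : T.η ▷ S.t ≫ l = (λ_ S.t).hom ≫ (ρ_ S.t).inv ≫ S.t ◁ T.η
  mul_T : T.μ ▷ S.t ≫ l =
    (α_ T.t T.t S.t).hom ≫ T.t ◁ l ≫ (α_ T.t S.t T.t).inv ≫ l ▷ T.t ≫
      (α_ S.t T.t T.t).hom ≫ S.t ◁ T.μ

/-- The hexagon for `l : R S ⇒ S R`, `l' : R' S' ⇒ S' R'`, `ρ : R' T ⇒ T R`,
`σ : S' T ⇒ T S`: the composites
`R' S' T ⇒ S' R' T ⇒ S' T R ⇒ T S R` and `R' S' T ⇒ R' T S ⇒ T R S ⇒ T S R` agree. -/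
def Hexagon {X X' : B} {r s : X ⟶ X} {r' s' : X' ⟶ X'} {T : X ⟶ X'}
    (l : s ≫ r ⟶ r ≫ s) (l' : s' ≫ r' ⟶ r' ≫ s')
    (ρ : T ≫ r' ⟶ r ≫ T) (σ : T ≫ s' ⟶ s ≫ T) : Prop :=
  T ◁ l' ≫ (α_ T r' s').inv ≫ ρ ▷ s' ≫ (α_ r T s').hom ≫ r ◁ σ =
    (α_ T s' r').inv ≫ σ ▷ r' ≫ (α_ s T r').hom ≫ s ◁ ρ ≫ (α_ s r T).inv ≫ l ▷ T ≫
      (α_ r s T).hom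

/-- The Yang-Baxter equation for `l₁₂ : S₁ S₂ ⇒ S₂ S₁`, `l₁₃ : S₁ S₃ ⇒ S₃ S₁` and
`l₂₃ : S₂ S₃ ⇒ S₃ S₂`: the composites
`S₁ S₂ S₃ ⇒ S₂ S₁ S₃ ⇒ S₂ S₃ S₁ ⇒ S₃ S₂ S₁` and
`S₁ S₂ S₃ ⇒ S₁ S₃ S₂ ⇒ S₃ S₁ S₂ ⇒ S₃ S₂ S₁` agree. -/
def YangBaxter {X : B} {s₁ s₂ s₃ : X ⟶ X} (l₁₂ : s₂ ≫ s₁ ⟶ s₁ ≫ s₂)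
    (l₁₃ : s₃ ≫ s₁ ⟶ s₁ ≫ s₃) (l₂₃ : s₃ ≫ s₂ ⟶ s₂ ≫ s₃) : Prop :=
  s₃ ◁ l₁₂ ≫ (α_ s₃ s₁ s₂).inv ≫ l₁₃ ▷ s₂ ≫ (α_ s₁ s₃ s₂).hom ≫ s₁ ◁ l₂₃ =
    (α_ s₃ s₂ s₁).inv ≫ l₂₃ ▷ s₁ ≫ (α_ s₂ s₃ s₁).hom ≫ s₂ ◁ l₁₃ ≫ (α_ s₂ s₁ s₃).inv ≫
      l₁₂ ▷ s₃ ≫ (α_ s₁ s₂ s₃).hom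

/-- The 2-cell of the identity 1-cell `(1, 1)`. -/
def idCell {X : B} (s : X ⟶ X) : 𝟙 X ≫ s ⟶ s ≫ 𝟙 X :=
  (λ_ s).hom ≫ (ρ_ s).inv

/-- The 2-cell `T' τ ∘ τ' T : S'' T' T ⇒ T' T S` of a composite `(T', τ') ∘ (T, τ)`. -/
def compCell {X X' X'' : B} {s : X ⟶ X} {s' : X' ⟶ X'} {s'' : X'' ⟶ X''}
    {T : X ⟶ X'} {T' : X' ⟶ X''} (τ : T ≫ s' ⟶ s ≫ T) (τ' : T' ≫ s'' ⟶ s' ≫ T') :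
    (T ≫ T') ≫ s'' ⟶ s ≫ (T ≫ T') :=
  (α_ T T' s'').hom ≫ T ◁ τ' ≫ (α_ T s' T').inv ≫ τ ▷ T' ≫ (α_ s T T').hom

theorem isMonadMor_id {X : B} (S : MonadOn X) : IsMonadMor S S (𝟙 X) (idCell S.t) where
  unit := by simp [idCell, unitors_equal, unitors_inv_equal]
  mul := by simp [idCell]

theorem isMonadMor_comp {X X' X'' : B} {S : MonadOn X} {S' : MonadOn X'} {S'' : MonadOn X''}
    {T : X ⟶ X'} {T' : X' ⟶ X''} {τ : T ≫ S'.t ⟶ S.t ≫ T} {τ' : T' ≫ S''.t ⟶ S'.t ≫ T'}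
    (h : IsMonadMor S S' T τ) (h' : IsMonadMor S' S'' T' τ') :
    IsMonadMor S S'' (T ≫ T') (compCell τ τ') where
  unit := by
    calc _ = 𝟙 _ ⊗≫ T ◁ (T' ◁ S''.η ≫ τ') ⊗≫ τ ▷ T' ⊗≫ 𝟙 _ := by
          simp only [compCell]; bicategory
      _ = 𝟙 _ ⊗≫ (T ◁ S'.η ≫ τ) ▷ T' ⊗≫ 𝟙 _ := by rw [h'.unit]; bicategory
      _ = _ := by rw [h.unit]; bicategory
  mul := by
    calc _ = 𝟙 _ ⊗≫ T ◁ (T' ◁ S''.μ ≫ τ') ⊗≫ τ ▷ T' ⊗≫ 𝟙 _ := by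
          simp only [compCell]; bicategory
      _ = 𝟙 _ ⊗≫ T ◁ τ' ▷ S''.t ⊗≫ T ◁ S'.t ◁ τ' ⊗≫ (T ◁ S'.μ ≫ τ) ▷ T' ⊗≫ 𝟙 _ := by
          rw [h'.mul]; bicategory
      _ = 𝟙 _ ⊗≫ T ◁ τ' ▷ S''.t ⊗≫ ((T ≫ S'.t) ◁ τ' ≫ τ ▷ (S'.t ≫ T')) ⊗≫ S.t ◁ τ ▷ T' ⊗≫
            S.μ ▷ T ▷ T' ⊗≫ 𝟙 _ := by
          rw [h.mul]; bicategory
      _ = _ := by rw [whisker_exchange]; simp only [compCell]; bicategory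

section Trans

variable {X X' X'' X''' : B} {s : X ⟶ X} {s' : X' ⟶ X'} {s'' : X'' ⟶ X''} {s''' : X''' ⟶ X'''}

theorem isMonadTrans_id {T : X ⟶ X'} (τ : T ≫ s' ⟶ s ≫ T) : IsMonadTrans τ τ (𝟙 T) := by
  simp [IsMonadTrans]

theorem isMonadTrans_comp {T T' T'' : X ⟶ X'} {τ : T ≫ s' ⟶ s ≫ T} {τ' : T' ≫ s' ⟶ s ≫ T'}
    {τ'' : T'' ≫ s' ⟶ s ≫ T''} {α : T ⟶ T'} {β : T' ⟶ T''}
    (h : IsMonadTrans τ τ' α) (h' : IsMonadTrans τ' τ'' β) : IsMonadTrans τ τ'' (α ≫ β) := by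
  simp only [IsMonadTrans] at *
  rw [comp_whiskerRight, Category.assoc, h', reassoc_of% h, Bicategory.whiskerLeft_comp]

theorem isMonadTrans_inv {T T' : X ⟶ X'} {τ : T ≫ s' ⟶ s ≫ T} {τ' : T' ≫ s' ⟶ s ≫ T'}
    {e : T ≅ T'} (h : IsMonadTrans τ τ' e.hom) : IsMonadTrans τ' τ e.inv := by
  simp only [IsMonadTrans] at *
  rw [← cancel_epi (e.hom ▷ s'), hom_inv_whiskerRight_assoc, reassoc_of% h,
    whiskerLeft_hom_inv, Category.comp_id]

theorem isMonadTrans_whiskerLeft {T : X ⟶ X'} {U U' : X' ⟶ X''} (τ : T ≫ s' ⟶ s ≫ T)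
    {υ : U ≫ s'' ⟶ s' ≫ U} {υ' : U' ≫ s'' ⟶ s' ≫ U'} {α : U ⟶ U'}
    (h : IsMonadTrans υ υ' α) :
    IsMonadTrans (compCell τ υ) (compCell τ υ') (T ◁ α) := by
  simp only [IsMonadTrans, compCell] at *
  calc _ = 𝟙 _ ⊗≫ T ◁ (α ▷ s'' ≫ υ') ⊗≫ τ ▷ U' ⊗≫ 𝟙 _ := by bicategory
    _ = 𝟙 _ ⊗≫ T ◁ υ ⊗≫ ((T ≫ s') ◁ α ≫ τ ▷ U') ⊗≫ 𝟙 _ := by rw [h]; bicategory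
    _ = _ := by rw [whisker_exchange]; bicategory

theorem isMonadTrans_whiskerRight {T T' : X ⟶ X'} {U : X' ⟶ X''} {τ : T ≫ s' ⟶ s ≫ T}
    {τ' : T' ≫ s' ⟶ s ≫ T'} (υ : U ≫ s'' ⟶ s' ≫ U) {α : T ⟶ T'}
    (h : IsMonadTrans τ τ' α) :
    IsMonadTrans (compCell τ υ) (compCell τ' υ) (α ▷ U) := by
  simp only [IsMonadTrans, compCell] at *
  calc _ = 𝟙 _ ⊗≫ (α ▷ (U ≫ s'') ≫ T' ◁ υ) ⊗≫ τ' ▷ U ⊗≫ 𝟙 _ := by bicategory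
    _ = 𝟙 _ ⊗≫ T ◁ υ ⊗≫ (α ▷ s' ≫ τ') ▷ U ⊗≫ 𝟙 _ := by rw [← whisker_exchange]; bicategory
    _ = _ := by rw [h]; bicategory

theorem isMonadTrans_associator {T : X ⟶ X'} {U : X' ⟶ X''} {V : X'' ⟶ X'''}
    (τ : T ≫ s' ⟶ s ≫ T) (υ : U ≫ s'' ⟶ s' ≫ U) (φ : V ≫ s''' ⟶ s'' ≫ V) :
    IsMonadTrans (compCell (compCell τ υ) φ) (compCell τ (compCell υ φ)) (α_ T U V).hom := by
  simp only [IsMonadTrans, compCell]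
  bicategory

theorem isMonadTrans_leftUnitor {T : X ⟶ X'} (τ : T ≫ s' ⟶ s ≫ T) :
    IsMonadTrans (compCell (idCell s) τ) τ (λ_ T).hom := by
  simp only [IsMonadTrans, compCell, idCell]
  bicategory

theorem isMonadTrans_rightUnitor {T : X ⟶ X'} (τ : T ≫ s' ⟶ s ≫ T) :
    IsMonadTrans (compCell τ (idCell s')) τ (ρ_ T).hom := by
  simp only [IsMonadTrans, compCell, idCell]
  bicategory

theorem eq_of_isMonadTrans_eqToHom {T T' : X ⟶ X'} {τ : T ≫ s' ⟶ s ≫ T}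
    {τ' : T' ≫ s' ⟶ s ≫ T'} (e : T = T') (h : IsMonadTrans τ τ' (eqToHom e)) : τ ≍ τ' := by
  subst e
  simpa [IsMonadTrans] using h.symm

end Trans

/-- The hexagon for `(l, l', ρ, σ)` says exactly that `σ` is a monad transformation between the
composites with `(_, l')` and `(_, l)`. -/
theorem Hexagon.isMonadTrans {X X' : B} {r s : X ⟶ X} {r' s' : X' ⟶ X'} {T : X ⟶ X'}
    {l : s ≫ r ⟶ r ≫ s} {l' : s' ≫ r' ⟶ r' ≫ s'} {ρ : T ≫ r' ⟶ r ≫ T}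
    {σ : T ≫ s' ⟶ s ≫ T} (h : Hexagon l l' ρ σ) :
    IsMonadTrans (compCell ρ l') (compCell l ρ) σ := by
  simp only [Hexagon] at h
  simp only [IsMonadTrans, compCell, Category.assoc, h, Iso.hom_inv_id_assoc]

theorem hexagon_id {X : B} {r s : X ⟶ X} (l : s ≫ r ⟶ r ≫ s) :
    Hexagon l l (idCell r) (idCell s) := by
  simp only [Hexagon, idCell]
  bicategory

theorem hexagon_comp {X X' X'' : B} {r s : X ⟶ X} {r' s' : X' ⟶ X'} {r'' s'' : X'' ⟶ X''}
    {T : X ⟶ X'} {T' : X' ⟶ X''} {l : s ≫ r ⟶ r ≫ s} {l' : s' ≫ r' ⟶ r' ≫ s'}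
    {l'' : s'' ≫ r'' ⟶ r'' ≫ s''} {ρ : T ≫ r' ⟶ r ≫ T} {σ : T ≫ s' ⟶ s ≫ T}
    {ρ' : T' ≫ r'' ⟶ r' ≫ T'} {σ' : T' ≫ s'' ⟶ s' ≫ T'}
    (h : Hexagon l l' ρ σ) (h' : Hexagon l' l'' ρ' σ') :
    Hexagon l l'' (compCell ρ ρ') (compCell σ σ') := by
  simp only [Hexagon, compCell] at *
  calc _ = 𝟙 _ ⊗≫ T ◁ (T' ◁ l'' ≫ (α_ T' r'' s'').inv ≫ ρ' ▷ s'') ⊗≫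
        (ρ ▷ (T' ≫ s'') ≫ (r ≫ T) ◁ σ') ⊗≫ r ◁ σ ▷ T' ⊗≫ 𝟙 _ := by bicategory
    _ = 𝟙 _ ⊗≫ T ◁ (T' ◁ l'' ≫ (α_ T' r'' s'').inv ≫ ρ' ▷ s'' ≫ (α_ r' T' s'').hom ≫
        r' ◁ σ') ⊗≫ ρ ▷ s' ▷ T' ⊗≫ r ◁ σ ▷ T' ⊗≫ 𝟙 _ := by
        rw [← whisker_exchange]; bicategory
    _ = 𝟙 _ ⊗≫ T ◁ σ' ▷ r'' ⊗≫ T ◁ s' ◁ ρ' ⊗≫ (T ◁ l' ≫ (α_ T r' s').inv ≫ ρ ▷ s' ≫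
        (α_ r T s').hom ≫ r ◁ σ) ▷ T' ⊗≫ 𝟙 _ := by
        rw [h']; bicategory
    _ = 𝟙 _ ⊗≫ T ◁ σ' ▷ r'' ⊗≫ ((T ≫ s') ◁ ρ' ≫ σ ▷ (r' ≫ T')) ⊗≫ s ◁ ρ ▷ T' ⊗≫
        l ▷ T ▷ T' ⊗≫ 𝟙 _ := by
        rw [h]; bicategory
    _ = _ := by rw [whisker_exchange]; bicategory

end Cells

/-- A 0-cell `(X, S)` of the 2-category of monads in `B`. -/
structure Mnd (B : Type u) [Bicategory.{w, v} B] where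
  X : B
  S : MonadOn X

namespace Mnd

variable {B : Type u} [Bicategory.{w, v} B]

/-- A monad morphism `(T, τ) : (X, S) ⟶ (X', S')`. -/
structure Hom (A A' : Mnd B) where
  T : A.X ⟶ A'.X
  τ : T ≫ A'.S.t ⟶ A.S.t ≫ T
  isMor : IsMonadMor A.S A'.S T τ

/-- A monad transformation. -/
@[ext]
structure Hom₂ {A A' : Mnd B} (f g : Hom A A') where
  hom : f.T ⟶ g.T
  isTrans : IsMonadTrans f.τ g.τ hom

instance : CategoryStruct (Mnd B) where
  Hom := Hom
  id A := ⟨𝟙 A.X, idCell A.S.t, isMonadMor_id A.S⟩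
  comp f g := ⟨f.T ≫ g.T, compCell f.τ g.τ, isMonadMor_comp f.isMor g.isMor⟩

instance (A A' : Mnd B) : Category (A ⟶ A') where
  Hom := Hom₂
  id f := ⟨𝟙 f.T, isMonadTrans_id f.τ⟩
  comp α β := ⟨α.hom ≫ β.hom, isMonadTrans_comp α.isTrans β.isTrans⟩
  id_comp _ := Hom₂.ext (Category.id_comp _)
  comp_id _ := Hom₂.ext (Category.comp_id _)
  assoc _ _ _ := Hom₂.ext (Category.assoc _ _ _)

@[ext]
theorem hom₂_ext {A A' : Mnd B} {f g : A ⟶ A'} {α β : f ⟶ g} (h : α.hom = β.hom) : α = β :=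
  Hom₂.ext h

@[simp] theorem id_T (A : Mnd B) : Hom.T (𝟙 A) = 𝟙 A.X := rfl
@[simp] theorem comp_T {A A' A'' : Mnd B} (f : A ⟶ A') (g : A' ⟶ A'') :
    Hom.T (f ≫ g) = f.T ≫ g.T := rfl
@[simp] theorem id_τ (A : Mnd B) : Hom.τ (𝟙 A) = idCell A.S.t := rfl
@[simp] theorem comp_τ {A A' A'' : Mnd B} (f : A ⟶ A') (g : A' ⟶ A'') :
    Hom.τ (f ≫ g) = compCell f.τ g.τ := rfl
@[simp] theorem id_hom {A A' : Mnd B} (f : A ⟶ A') : Hom₂.hom (𝟙 f) = 𝟙 f.T := rfl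
@[simp] theorem comp_hom {A A' : Mnd B} {f g h : A ⟶ A'} (α : f ⟶ g) (β : g ⟶ h) :
    Hom₂.hom (α ≫ β) = α.hom ≫ β.hom := rfl

/-- The 2-cell of `Mnd B` given by a monad transformation. -/
abbrev mkHom₂ {A A' : Mnd B} {f g : A ⟶ A'} (α : f.T ⟶ g.T) (h : IsMonadTrans f.τ g.τ α) :
    f ⟶ g :=
  Hom₂.mk α h

/-- An invertible 2-cell of `B` that is a monad transformation is invertible in `Mnd B`. -/
@[simps]
def isoMk {A A' : Mnd B} {f g : A ⟶ A'} (e : f.T ≅ g.T) (h : IsMonadTrans f.τ g.τ e.hom) :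
    f ≅ g where
  hom := mkHom₂ e.hom h
  inv := mkHom₂ e.inv (isMonadTrans_inv h)
  hom_inv_id := hom₂_ext e.hom_inv_id
  inv_hom_id := hom₂_ext e.inv_hom_id

/-- The 2-category of monads in `B`: 1-cells compose by
`(T', τ') ∘ (T, τ) = (T' T, T' τ ∘ τ' T)`, and 2-cells compose as in `B`. -/
instance : Bicategory (Mnd B) where
  homCategory := inferInstance
  whiskerLeft {A A' A''} f g h α := (mkHom₂ (Hom.T f ◁ Hom₂.hom α)
    (isMonadTrans_whiskerLeft (Hom.τ f) (Hom₂.isTrans α)) : f ≫ g ⟶ f ≫ h)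
  whiskerRight {A A' A''} f g α h := (mkHom₂ (Hom₂.hom α ▷ Hom.T h)
    (isMonadTrans_whiskerRight (Hom.τ h) (Hom₂.isTrans α)) : f ≫ h ⟶ g ≫ h)
  associator f g h := (isoMk (α_ (Hom.T f) (Hom.T g) (Hom.T h))
    (isMonadTrans_associator (Hom.τ f) (Hom.τ g) (Hom.τ h)) : (f ≫ g) ≫ h ≅ f ≫ g ≫ h)
  leftUnitor {A A'} f := (isoMk (λ_ (Hom.T f)) (isMonadTrans_leftUnitor (Hom.τ f)) : 𝟙 A ≫ f ≅ f)
  rightUnitor {A A'} f :=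
    (isoMk (ρ_ (Hom.T f)) (isMonadTrans_rightUnitor (Hom.τ f)) : f ≫ 𝟙 A' ≅ f)
  whisker_exchange α β := hom₂_ext (whisker_exchange (Hom₂.hom α) (Hom₂.hom β))

section Simp

variable {A A' A'' A''' : Mnd B}

@[simp] theorem whiskerLeft_hom (f : A ⟶ A') {g h : A' ⟶ A''} (α : g ⟶ h) :
    Hom₂.hom (f ◁ α) = Hom.T f ◁ Hom₂.hom α := rfl
@[simp] theorem whiskerRight_hom {f g : A ⟶ A'} (α : f ⟶ g) (h : A' ⟶ A'') :
    Hom₂.hom (α ▷ h) = Hom₂.hom α ▷ Hom.T h := rfl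
@[simp] theorem associator_hom_hom (f : A ⟶ A') (g : A' ⟶ A'') (h : A'' ⟶ A''') :
    Hom₂.hom (α_ f g h).hom = (α_ (Hom.T f) (Hom.T g) (Hom.T h)).hom := rfl
@[simp] theorem associator_inv_hom (f : A ⟶ A') (g : A' ⟶ A'') (h : A'' ⟶ A''') :
    Hom₂.hom (α_ f g h).inv = (α_ (Hom.T f) (Hom.T g) (Hom.T h)).inv := rfl
@[simp] theorem leftUnitor_hom_hom (f : A ⟶ A') :
    Hom₂.hom (λ_ f).hom = (λ_ (Hom.T f)).hom := rfl
@[simp] theorem leftUnitor_inv_hom (f : A ⟶ A') :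
    Hom₂.hom (λ_ f).inv = (λ_ (Hom.T f)).inv := rfl
@[simp] theorem rightUnitor_hom_hom (f : A ⟶ A') :
    Hom₂.hom (ρ_ f).hom = (ρ_ (Hom.T f)).hom := rfl
@[simp] theorem rightUnitor_inv_hom (f : A ⟶ A') :
    Hom₂.hom (ρ_ f).inv = (ρ_ (Hom.T f)).inv := rfl

end Simp

theorem hom_ext {A A' : Mnd B} {f g : A ⟶ A'} (e : Hom.T f = Hom.T g)
    (h : IsMonadTrans (Hom.τ f) (Hom.τ g) (eqToHom e)) : f = g := by
  have := eq_of_isMonadTrans_eqToHom e h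
  obtain ⟨T, τ, _⟩ : Hom A A' := f
  obtain ⟨T', τ', _⟩ : Hom A A' := g
  obtain rfl : T = T' := e
  obtain rfl : τ = τ' := eq_of_heq this
  rfl

@[simp]
theorem eqToHom_hom {A A' : Mnd B} {f g : A ⟶ A'} (e : f = g) :
    Hom₂.hom (eqToHom e) = eqToHom (congrArg Hom.T e) := by
  subst e; rfl

instance [Strict B] : Strict (Mnd B) where
  id_comp f := hom_ext (Strict.id_comp (Hom.T f)) (by
    simpa [Strict.leftUnitor_eqToIso] using isMonadTrans_leftUnitor (Hom.τ f))
  comp_id f := hom_ext (Strict.comp_id (Hom.T f)) (by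
    simpa [Strict.rightUnitor_eqToIso] using isMonadTrans_rightUnitor (Hom.τ f))
  assoc f g h := hom_ext (Strict.assoc (Hom.T f) (Hom.T g) (Hom.T h)) (by
    simpa [Strict.associator_eqToIso] using
      isMonadTrans_associator (Hom.τ f) (Hom.τ g) (Hom.τ h))
  leftUnitor_eqToIso f := by ext; simp [Strict.leftUnitor_eqToIso]
  rightUnitor_eqToIso f := by ext; simp [Strict.rightUnitor_eqToIso]
  associator_eqToIso f g h := by ext; simp [Strict.associator_eqToIso]

/-- The 2-functor `(X, S) ↦ X`, `(T, τ) ↦ T`, `α ↦ α`. -/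
def forget (B : Type u) [Bicategory.{w, v} B] : StrictPseudofunctor (Mnd B) B :=
  StrictPseudofunctor.mk' { obj A := A.X, map f := Hom.T f, map₂ α := Hom₂.hom α }

end Mnd

section Functoriality

variable {B : Type u} [Bicategory.{w, v} B] {C : Type u'} [Bicategory.{w', v'} C]

theorem map₂_lu_inv (F : Pseudofunctor B C) {a b : B} (f : a ⟶ b) :
    F.map₂ (λ_ f).inv = (λ_ (F.map f)).inv ≫ (F.mapId a).inv ▷ F.map f ≫
      (F.mapComp (𝟙 a) f).inv := by
  rw [← cancel_epi (F.map₂ (λ_ f).hom), ← F.map₂_comp, Iso.hom_inv_id]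
  simp

theorem map₂_ru_inv (F : Pseudofunctor B C) {a b : B} (f : a ⟶ b) :
    F.map₂ (ρ_ f).inv = (ρ_ (F.map f)).inv ≫ F.map f ◁ (F.mapId b).inv ≫
      (F.mapComp f (𝟙 b)).inv := by
  rw [← cancel_epi (F.map₂ (ρ_ f).hom), ← F.map₂_comp, Iso.hom_inv_id]
  simp

theorem map₂_as_inv (F : Pseudofunctor B C) {a b c d : B} (f : a ⟶ b) (g : b ⟶ c) (h : c ⟶ d) :
    F.map₂ (α_ f g h).inv = (F.mapComp f (g ≫ h)).hom ≫ F.map f ◁ (F.mapComp g h).hom ≫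
      (α_ (F.map f) (F.map g) (F.map h)).inv ≫ (F.mapComp f g).inv ▷ F.map h ≫
      (F.mapComp (f ≫ g) h).inv := by
  rw [← cancel_epi (F.map₂ (α_ f g h).hom), ← F.map₂_comp, Iso.hom_inv_id]
  simp

/-- The image of a monad under a 2-functor. -/
@[simps]
def MonadOn.map (F : StrictPseudofunctor B C) {X : B} (S : MonadOn X) : MonadOn (F.obj X) where
  t := F.map S.t
  η := (F.mapId X).inv ≫ F.map₂ S.η
  μ := (F.mapComp S.t S.t).inv ≫ F.map₂ S.μ
  unit_right := by
    have h := congrArg F.map₂ S.unit_right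
    simpa [map₂_lu_inv] using h
  unit_left := by
    have h := congrArg F.map₂ S.unit_left
    simpa [map₂_ru_inv] using h
  assoc := by
    have h := congrArg F.map₂ S.assoc
    rw [← cancel_epi ((F.mapComp S.t S.t).hom ▷ F.map S.t),
      ← cancel_epi (F.mapComp (S.t ≫ S.t) S.t).hom]
    simpa using h

/-- The image of a 2-cell `S' T ⇒ T S` under a 2-functor. -/
def mapCell (F : StrictPseudofunctor B C) {X X' : B} {s : X ⟶ X} {s' : X' ⟶ X'} {T : X ⟶ X'}
    (τ : T ≫ s' ⟶ s ≫ T) : F.map T ≫ F.map s' ⟶ F.map s ≫ F.map T :=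
  (F.mapComp T s').inv ≫ F.map₂ τ ≫ (F.mapComp s T).hom

theorem isMonadMor_map (F : StrictPseudofunctor B C) {X X' : B} {S : MonadOn X} {S' : MonadOn X'}
    {T : X ⟶ X'} {τ : T ≫ S'.t ⟶ S.t ≫ T} (h : IsMonadMor S S' T τ) :
    IsMonadMor (S.map F) (S'.map F) (F.map T) (mapCell F τ) where
  unit := by
    have h := congrArg F.map₂ h.unit
    change F.map T ◁ ((F.mapId X').inv ≫ F.map₂ S'.η) ≫ mapCell F τ =
      (ρ_ (F.map T)).hom ≫ (λ_ (F.map T)).inv ≫ ((F.mapId X).inv ≫ F.map₂ S.η) ▷ F.map T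
    rw [← cancel_epi (F.map T ◁ (F.mapId X').hom), ← cancel_epi (F.mapComp T (𝟙 X')).hom,
      ← cancel_mono (F.mapComp S.t T).inv]
    simpa [mapCell, map₂_lu_inv] using h
  mul := by
    have h := congrArg F.map₂ h.mul
    change F.map T ◁ ((F.mapComp S'.t S'.t).inv ≫ F.map₂ S'.μ) ≫ mapCell F τ =
      (α_ (F.map T) (F.map S'.t) (F.map S'.t)).inv ≫ mapCell F τ ▷ F.map S'.t ≫
        (α_ (F.map S.t) (F.map T) (F.map S'.t)).hom ≫ F.map S.t ◁ mapCell F τ ≫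
        (α_ (F.map S.t) (F.map S.t) (F.map T)).inv ≫
        ((F.mapComp S.t S.t).inv ≫ F.map₂ S.μ) ▷ F.map T
    rw [← cancel_epi (F.map T ◁ (F.mapComp S'.t S'.t).hom),
      ← cancel_epi (F.mapComp T (S'.t ≫ S'.t)).hom, ← cancel_mono (F.mapComp S.t T).inv]
    simpa [mapCell, map₂_as_inv] using h

theorem isMonadTrans_map (F : StrictPseudofunctor B C) {X X' : B} {s : X ⟶ X} {s' : X' ⟶ X'}
    {T T' : X ⟶ X'} {τ : T ≫ s' ⟶ s ≫ T} {τ' : T' ≫ s' ⟶ s ≫ T'} {α : T ⟶ T'}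
    (h : IsMonadTrans τ τ' α) : IsMonadTrans (mapCell F τ) (mapCell F τ') (F.map₂ α) := by
  have h := congrArg F.map₂ h
  rw [IsMonadTrans, ← cancel_epi (F.mapComp T s').hom, ← cancel_mono (F.mapComp s T').inv]
  simpa [mapCell] using h

theorem isMonadTrans_mapId (F : StrictPseudofunctor B C) {X : B} (s : X ⟶ X) :
    IsMonadTrans (mapCell F (idCell s)) (idCell (F.map s)) (F.mapId X).hom := by
  simp [IsMonadTrans, mapCell, idCell, map₂_ru_inv]

theorem isMonadTrans_mapComp (F : StrictPseudofunctor B C) {X X' X'' : B} {s : X ⟶ X}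
    {s' : X' ⟶ X'} {s'' : X'' ⟶ X''} {T : X ⟶ X'} {T' : X' ⟶ X''}
    (τ : T ≫ s' ⟶ s ≫ T) (τ' : T' ≫ s'' ⟶ s' ≫ T') :
    IsMonadTrans (mapCell F (compCell τ τ')) (compCell (mapCell F τ) (mapCell F τ'))
      (F.mapComp T T').hom := by
  simp [IsMonadTrans, mapCell, compCell, map₂_as_inv]

/-- The action of `Mnd` on 2-functors: `Mnd F` sends `(X, S)` to `(F X, F S)`, `(T, τ)` to
`(F T, F τ)` and `α` to `F α`. -/
def Mnd.map [Strict B] [Strict C] (F : StrictPseudofunctor B C) :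
    StrictPseudofunctor (Mnd B) (Mnd C) :=
  StrictPseudofunctor.mk'' {
    obj A := ⟨F.obj A.X, A.S.map F⟩
    map f := ⟨F.map (Hom.T f), mapCell F (Hom.τ f), isMonadMor_map F (Hom.isMor f)⟩
    map₂ α := mkHom₂ (F.map₂ (Hom₂.hom α)) (isMonadTrans_map F (Hom₂.isTrans α))
    map₂_id f := hom₂_ext (F.map₂_id (Hom.T f))
    map₂_comp α β := hom₂_ext (F.map₂_comp (Hom₂.hom α) (Hom₂.hom β))
    map_id A := hom_ext (F.map_id A.X) (by
      have h := isMonadTrans_mapId F A.S.t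
      rw [F.mapId_eq_eqToIso] at h
      exact h)
    map_comp f g := hom_ext (F.map_comp (Hom.T f) (Hom.T g)) (by
      have h := isMonadTrans_mapComp F (Hom.τ f) (Hom.τ g)
      rw [F.mapComp_eq_eqToIso] at h
      exact h)
    map₂_whisker_left f g h α := by
      ext; simp [F.mapComp_eq_eqToIso]
    map₂_whisker_right α h := by
      ext; simp [F.mapComp_eq_eqToIso] }

end Functoriality

/-- A distributive series of `n` monads in `B`: monads `S i` on a 0-cell `X`, distributive laws
`l i j : S i S j ⇒ S j S i` for `i < j`, and the Yang-Baxter equation for all `i < j < k`. -/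
structure DistSeries (B : Type u) [Bicategory.{w, v} B] (n : ℕ) where
  X : B
  S : Fin n → MonadOn X
  l : ∀ i j : Fin n, i < j → ((S j).t ≫ (S i).t ⟶ (S i).t ≫ (S j).t)
  isDistLaw : ∀ (i j : Fin n) (h : i < j), IsDistLaw (S i) (S j) (l i j h)
  yangBaxter : ∀ (i j k : Fin n) (hij : i < j) (hjk : j < k),
    YangBaxter (l i j hij) (l i k (hij.trans hjk)) (l j k hjk)

namespace DistSeries

variable {B : Type u} [Bicategory.{w, v} B] {n : ℕ}

/-- A 1-cell `(T, τ i)`: monad morphisms `(T, τ i) : (X, S i) ⟶ (X', S' i)` satisfying the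
hexagon with the distributive laws for all `i < j`. -/
structure Hom (A A' : DistSeries B n) where
  T : A.X ⟶ A'.X
  τ : ∀ i, T ≫ (A'.S i).t ⟶ (A.S i).t ≫ T
  isMor : ∀ i, IsMonadMor (A.S i) (A'.S i) T (τ i)
  hexagon : ∀ (i j : Fin n) (h : i < j), Hexagon (A.l i j h) (A'.l i j h) (τ i) (τ j)

/-- A 2-cell: `α : T ⇒ T'` that is a monad transformation `(T, τ i) ⇒ (T', τ' i)` for all `i`. -/
@[ext]
structure Hom₂ {A A' : DistSeries B n} (f g : Hom A A') where
  hom : f.T ⟶ g.T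
  isTrans : ∀ i, IsMonadTrans (f.τ i) (g.τ i) hom

instance : CategoryStruct (DistSeries B n) where
  Hom := Hom
  id A := ⟨𝟙 A.X, fun i => idCell (A.S i).t, fun i => isMonadMor_id (A.S i),
    fun i j h => hexagon_id (A.l i j h)⟩
  comp f g := ⟨f.T ≫ g.T, fun i => compCell (f.τ i) (g.τ i),
    fun i => isMonadMor_comp (f.isMor i) (g.isMor i),
    fun i j h => hexagon_comp (f.hexagon i j h) (g.hexagon i j h)⟩

instance (A A' : DistSeries B n) : Category (A ⟶ A') where
  Hom := Hom₂
  id f := ⟨𝟙 f.T, fun i => isMonadTrans_id (f.τ i)⟩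
  comp α β := ⟨α.hom ≫ β.hom, fun i => isMonadTrans_comp (α.isTrans i) (β.isTrans i)⟩
  id_comp _ := Hom₂.ext (Category.id_comp _)
  comp_id _ := Hom₂.ext (Category.comp_id _)
  assoc _ _ _ := Hom₂.ext (Category.assoc _ _ _)

@[ext]
theorem hom₂_ext {A A' : DistSeries B n} {f g : A ⟶ A'} {α β : f ⟶ g} (h : α.hom = β.hom) :
    α = β :=
  Hom₂.ext h

@[simp] theorem id_T (A : DistSeries B n) : Hom.T (𝟙 A) = 𝟙 A.X := rfl
@[simp] theorem comp_T {A A' A'' : DistSeries B n} (f : A ⟶ A') (g : A' ⟶ A'') :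
    Hom.T (f ≫ g) = f.T ≫ g.T := rfl
@[simp] theorem id_τ (A : DistSeries B n) (i : Fin n) : Hom.τ (𝟙 A) i = idCell (A.S i).t := rfl
@[simp] theorem comp_τ {A A' A'' : DistSeries B n} (f : A ⟶ A') (g : A' ⟶ A'') (i : Fin n) :
    Hom.τ (f ≫ g) i = compCell (f.τ i) (g.τ i) := rfl
@[simp] theorem id_hom {A A' : DistSeries B n} (f : A ⟶ A') : Hom₂.hom (𝟙 f) = 𝟙 f.T := rfl
@[simp] theorem comp_hom {A A' : DistSeries B n} {f g h : A ⟶ A'} (α : f ⟶ g) (β : g ⟶ h) :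
    Hom₂.hom (α ≫ β) = α.hom ≫ β.hom := rfl

/-- The 2-cell of `DistSeries B n` given by a compatible 2-cell of `B`. -/
abbrev mkHom₂ {A A' : DistSeries B n} {f g : A ⟶ A'} (α : f.T ⟶ g.T)
    (h : ∀ i, IsMonadTrans (f.τ i) (g.τ i) α) : f ⟶ g :=
  Hom₂.mk α h

/-- An invertible compatible 2-cell of `B` is invertible in `DistSeries B n`. -/
@[simps]
def isoMk {A A' : DistSeries B n} {f g : A ⟶ A'} (e : f.T ≅ g.T)
    (h : ∀ i, IsMonadTrans (f.τ i) (g.τ i) e.hom) : f ≅ g where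
  hom := mkHom₂ e.hom h
  inv := mkHom₂ e.inv (fun i => isMonadTrans_inv (h i))
  hom_inv_id := hom₂_ext e.hom_inv_id
  inv_hom_id := hom₂_ext e.inv_hom_id

/-- The 2-category of distributive series of `n` monads in `B`: 1-cells compose by
`(T', τ' i) ∘ (T, τ i) = (T' T, T' (τ i) ∘ (τ' i) T)`, and 2-cells compose as in `B`. -/
instance : Bicategory (DistSeries B n) where
  homCategory := inferInstance
  whiskerLeft {A A' A''} f g h α := (mkHom₂ (Hom.T f ◁ Hom₂.hom α)
    (fun i => isMonadTrans_whiskerLeft (Hom.τ f i) (Hom₂.isTrans α i)) : f ≫ g ⟶ f ≫ h)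
  whiskerRight {A A' A''} f g α h := (mkHom₂ (Hom₂.hom α ▷ Hom.T h)
    (fun i => isMonadTrans_whiskerRight (Hom.τ h i) (Hom₂.isTrans α i)) : f ≫ h ⟶ g ≫ h)
  associator f g h := (isoMk (α_ (Hom.T f) (Hom.T g) (Hom.T h))
    (fun i => isMonadTrans_associator (Hom.τ f i) (Hom.τ g i) (Hom.τ h i)) :
      (f ≫ g) ≫ h ≅ f ≫ g ≫ h)
  leftUnitor {A A'} f := (isoMk (λ_ (Hom.T f))
    (fun i => isMonadTrans_leftUnitor (Hom.τ f i)) : 𝟙 A ≫ f ≅ f)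
  rightUnitor {A A'} f := (isoMk (ρ_ (Hom.T f))
    (fun i => isMonadTrans_rightUnitor (Hom.τ f i)) : f ≫ 𝟙 A' ≅ f)
  whisker_exchange α β := hom₂_ext (whisker_exchange (Hom₂.hom α) (Hom₂.hom β))

section Simp

variable {A A' A'' A''' : DistSeries B n}

@[simp] theorem whiskerLeft_hom (f : A ⟶ A') {g h : A' ⟶ A''} (α : g ⟶ h) :
    Hom₂.hom (f ◁ α) = Hom.T f ◁ Hom₂.hom α := rfl
@[simp] theorem whiskerRight_hom {f g : A ⟶ A'} (α : f ⟶ g) (h : A' ⟶ A'') :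
    Hom₂.hom (α ▷ h) = Hom₂.hom α ▷ Hom.T h := rfl
@[simp] theorem associator_hom_hom (f : A ⟶ A') (g : A' ⟶ A'') (h : A'' ⟶ A''') :
    Hom₂.hom (α_ f g h).hom = (α_ (Hom.T f) (Hom.T g) (Hom.T h)).hom := rfl
@[simp] theorem associator_inv_hom (f : A ⟶ A') (g : A' ⟶ A'') (h : A'' ⟶ A''') :
    Hom₂.hom (α_ f g h).inv = (α_ (Hom.T f) (Hom.T g) (Hom.T h)).inv := rfl
@[simp] theorem leftUnitor_hom_hom (f : A ⟶ A') :
    Hom₂.hom (λ_ f).hom = (λ_ (Hom.T f)).hom := rfl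
@[simp] theorem leftUnitor_inv_hom (f : A ⟶ A') :
    Hom₂.hom (λ_ f).inv = (λ_ (Hom.T f)).inv := rfl
@[simp] theorem rightUnitor_hom_hom (f : A ⟶ A') :
    Hom₂.hom (ρ_ f).hom = (ρ_ (Hom.T f)).hom := rfl
@[simp] theorem rightUnitor_inv_hom (f : A ⟶ A') :
    Hom₂.hom (ρ_ f).inv = (ρ_ (Hom.T f)).inv := rfl

end Simp

theorem hom_ext {A A' : DistSeries B n} {f g : A ⟶ A'} (e : Hom.T f = Hom.T g)
    (h : ∀ i, IsMonadTrans (Hom.τ f i) (Hom.τ g i) (eqToHom e)) : f = g := by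
  have := fun i => eq_of_isMonadTrans_eqToHom e (h i)
  obtain ⟨T, τ, _, _⟩ : Hom A A' := f
  obtain ⟨T', τ', _, _⟩ : Hom A A' := g
  obtain rfl : T = T' := e
  obtain rfl : τ = τ' := funext fun i => eq_of_heq (this i)
  rfl

@[simp]
theorem eqToHom_hom {A A' : DistSeries B n} {f g : A ⟶ A'} (e : f = g) :
    Hom₂.hom (eqToHom e) = eqToHom (congrArg Hom.T e) := by
  subst e; rfl

instance [Strict B] : Strict (DistSeries B n) where
  id_comp f := hom_ext (Strict.id_comp (Hom.T f)) (fun i => by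
    simpa [Strict.leftUnitor_eqToIso] using isMonadTrans_leftUnitor (Hom.τ f i))
  comp_id f := hom_ext (Strict.comp_id (Hom.T f)) (fun i => by
    simpa [Strict.rightUnitor_eqToIso] using isMonadTrans_rightUnitor (Hom.τ f i))
  assoc f g h := hom_ext (Strict.assoc (Hom.T f) (Hom.T g) (Hom.T h)) (fun i => by
    simpa [Strict.associator_eqToIso] using
      isMonadTrans_associator (Hom.τ f i) (Hom.τ g i) (Hom.τ h i))
  leftUnitor_eqToIso f := by ext; simp [Strict.leftUnitor_eqToIso]
  rightUnitor_eqToIso f := by ext; simp [Strict.rightUnitor_eqToIso]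
  associator_eqToIso f g h := by ext; simp [Strict.associator_eqToIso]

/-- The 2-functor keeping only the `i`-th monad:
`(X, S, l) ↦ (X, S i)`, `(T, τ) ↦ (T, τ i)`, `α ↦ α`. -/
def proj (B : Type u) [Bicategory.{w, v} B] {n : ℕ} (i : Fin n) :
    StrictPseudofunctor (DistSeries B n) (Mnd B) :=
  StrictPseudofunctor.mk' {
    obj A := ⟨A.X, A.S i⟩
    map f := ⟨Hom.T f, Hom.τ f i, Hom.isMor f i⟩
    map₂ α := Mnd.mkHom₂ (Hom₂.hom α) (Hom₂.isTrans α i) }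

/-- A distributive law of `S` over `T`, as the monad `(T, l)` on `(X, S)` in `Mnd B`. -/
def distLawMonad {X : B} {S T : MonadOn X} {l : T.t ≫ S.t ⟶ S.t ≫ T.t}
    (h : IsDistLaw S T l) : MonadOn (Mnd.mk X S) where
  t := ⟨T.t, l, ⟨h.unit_S, h.mul_S⟩⟩
  η := Mnd.mkHom₂ T.η (by simpa [IsMonadTrans, idCell] using h.unit_T)
  μ := Mnd.mkHom₂ T.μ (by simpa [IsMonadTrans, compCell] using h.mul_T)
  unit_right := Mnd.hom₂_ext T.unit_right
  unit_left := Mnd.hom₂_ext T.unit_left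
  assoc := Mnd.hom₂_ext T.assoc

section PairProj

variable (i j : Fin n) (h : i < j)

/-- The 0-cell `((X, S i), (S j, l i j))`. -/
def pairObj (A : DistSeries B n) : Mnd (Mnd B) :=
  ⟨⟨A.X, A.S i⟩, distLawMonad (A.isDistLaw i j h)⟩

/-- The 1-cell `((T, τ i), τ j)`. -/
def pairHom {A A' : DistSeries B n} (f : A ⟶ A') : pairObj i j h A ⟶ pairObj i j h A' :=
  Mnd.Hom.mk (A := pairObj i j h A) (A' := pairObj i j h A')
    (Mnd.Hom.mk (A := ⟨A.X, A.S i⟩) (A' := ⟨A'.X, A'.S i⟩) f.T (f.τ i) (f.isMor i))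
    (Mnd.Hom₂.mk (f.τ j) (f.hexagon i j h).isMonadTrans)
    ⟨Mnd.hom₂_ext (f.isMor j).unit, Mnd.hom₂_ext (f.isMor j).mul⟩

/-- The 2-cell `α`. -/
def pairHom₂ {A A' : DistSeries B n} {f g : A ⟶ A'} (α : f ⟶ g) :
    pairHom i j h f ⟶ pairHom i j h g :=
  Mnd.Hom₂.mk (f := pairHom i j h f) (g := pairHom i j h g)
    (Mnd.Hom₂.mk (f := (pairHom i j h f).T) (g := (pairHom i j h g).T) α.hom (α.isTrans i))
    (Mnd.hom₂_ext (α.isTrans j))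

end PairProj

/-- The 2-functor keeping only the distributive law `l i j`:
`(X, S, l) ↦ ((X, S i), (S j, l i j))`, `(T, τ) ↦ ((T, τ i), τ j)`, `α ↦ α`. -/
def pairProj (B : Type u) [Bicategory.{w, v} B] {n : ℕ} (i j : Fin n) (h : i < j) :
    StrictPseudofunctor (DistSeries B n) (Mnd (Mnd B)) :=
  StrictPseudofunctor.mk' {
    obj A := pairObj i j h A
    map f := pairHom i j h f
    map₂ α := pairHom₂ i j h α
    map₂_id _ := rfl
    map₂_comp _ _ := rfl
    map_id _ := rfl
    map_comp _ _ := rfl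
    map₂_whisker_left _ _ _ _ := ((Category.id_comp _).trans (Category.comp_id _)).symm
    map₂_whisker_right _ _ := ((Category.id_comp _).trans (Category.comp_id _)).symm
    map₂_left_unitor _ := (Category.id_comp _).symm
    map₂_right_unitor _ := (Category.id_comp _).symm
    map₂_associator _ _ _ := ((Category.id_comp _).trans (Category.comp_id _)).symm }

end DistSeries

set_option linter.checkUnivs false in
/-- A (strict) 2-category. -/
structure TwoCat : Type (max (w + 1) (v + 1) (u + 1)) where
  carrier : Type u
  [bicategory : Bicategory.{w, v} carrier]
  [strict : Strict carrier]

instance : CoeSort TwoCat.{w, v, u} (Type u) := ⟨TwoCat.carrier⟩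

attribute [instance] TwoCat.bicategory TwoCat.strict

/-- `mndPow B k` is the 2-category `Mnd^(k+1) B`, obtained by applying `Mnd` to `B` `k + 1`
times. -/
def mndPow (B : TwoCat.{w, v, u}) : ℕ → TwoCat.{w, max v w, max u v w}
  | 0 => ⟨Mnd B⟩
  | k + 1 => ⟨Mnd (mndPow B k)⟩

/-- The underlying 2-functor `Mnd^(k+1) B ⟶ B`. -/
def mndPowBase (B : TwoCat.{w, v, u}) : ∀ k : ℕ, StrictPseudofunctor (mndPow B k) B
  | 0 => Mnd.forget B
  | k + 1 => (Mnd.forget (mndPow B k)).comp (mndPowBase B k)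

/-- The 2-functor `Mnd^(k+1) B ⟶ Mnd B` extracting the monad adjoined at the `i`-th stage. -/
def mndPowProj (B : TwoCat.{w, v, u}) :
    ∀ (k : ℕ) (_ : Fin (k + 1)), StrictPseudofunctor (mndPow B k) (Mnd B)
  | 0, _ => StrictPseudofunctor.id (Mnd B)
  | k + 1, i => Fin.lastCases (motive := fun _ => StrictPseudofunctor (mndPow B (k + 1)) (Mnd B))
      (Mnd.map (mndPowBase B k))
      (fun i' => (Mnd.forget (mndPow B k)).comp (mndPowProj B k i')) i

/-- The 2-functor `Mnd^(k+1) B ⟶ Mnd (Mnd B)` extracting the monads adjoined at the stages `i` and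
`j`, together with the distributive law between them. -/
def mndPowPairProj (B : TwoCat.{w, v, u}) :
    ∀ (k : ℕ) (i j : Fin (k + 1)) (_ : i < j), StrictPseudofunctor (mndPow B k) (Mnd (Mnd B))
  | 0, i, j, h => absurd h (by omega)
  | k + 1, i, j, h =>
    if hj : j = Fin.last (k + 1) then
      Mnd.map (mndPowProj B k (i.castPred (h.trans_le (Fin.le_last j)).ne))
    else
      (Mnd.forget (mndPow B k)).comp
        (mndPowPairProj B k (i.castPred (h.trans_le (Fin.le_last j)).ne) (j.castPred hj)
          (by simpa using h))

/-- A 2-functor is an isomorphism of 2-categories: it is bijective on 0-cells, on 1-cells and on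
2-cells. -/
structure IsIsoTwoFunctor {B : Type u} [Bicategory.{w, v} B] {C : Type u'}
    [Bicategory.{w', v'} C] (F : StrictPseudofunctor B C) : Prop where
  bijective_obj : Function.Bijective F.obj
  bijective_map : ∀ X Y : B, Function.Bijective (fun f : X ⟶ Y => F.map f)
  bijective_map₂ : ∀ (X Y : B) (f g : X ⟶ Y), Function.Bijective (fun α : f ⟶ g => F.map₂ α)

end FormalMonads

/-! The proof is an induction on the number of monads; `mndPow B k` corresponds to series of `k + 1`
monads. Unfold a monad in the 2-category of series of `n` monads. Its 1-cell is some `T` with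
2-cells `τ i`; that each `(T, τ i)` is a monad morphism is the half of the distributive law
involving `S i`, and that the unit and multiplication are 2-cells of series is the half involving
`T`. The hexagon for this endo-1-cell is the Yang–Baxter equation for `i < j < last`. Likewise, for
a monad morphism, the condition that its 2-cell is a 2-cell of series is the hexagon for `i < last`.
Hence `toMnd` presents a series of `n + 1` monads as a monad on the series of the first `n`.

The comparison `toMndPow` is `toMnd` followed by `Mnd.map` of the previous comparison. Its
surjectivity on cells of each dimension is proved by induction: `isSurjectiveTwoFunctor_toMnd`
handles the first factor, `IsIsoTwoFunctor.surjective_mndMap` the second. Injectivity needs no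
separate induction. The comparison is compatible with the base 2-functor, with every single
projection and with every pair projection, and these jointly determine a series, its 1-cells and its
2-cells (`isIsoTwoFunctor_of_comp_eq_proj`). The same compatibilities are the remaining claims of
the theorem. -/

namespace FormalMonads

/-! ### Equality of strict 2-functors. -/

section StrictPseudofunctor

variable {B : Type u} [Bicategory.{w, v} B] {C : Type u'} [Bicategory.{w', v'} C]

/-- Strictness forces the comparison isomorphisms to be `eqToIso`, so they carry no data beyond the
action on cells. -/
theorem strictPseudofunctor_ext {F G : StrictPseudofunctor B C}
    (hobj : ∀ X, F.obj X = G.obj X)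
    (hmap : ∀ {X Y : B} (f : X ⟶ Y), F.map f ≍ G.map f)
    (hmap₂ : ∀ {X Y : B} {f g : X ⟶ Y} (α : f ⟶ g), F.map₂ α ≍ G.map₂ α) : F = G := by
  obtain ⟨⟨⟨⟨⟨⟨Fo, Fm⟩, F2⟩, _, _⟩, Fi, Fc, _, _, _, _, _⟩, Fi', Fi''⟩, Fc', Fc''⟩ := F
  obtain ⟨⟨⟨⟨⟨⟨Go, Gm⟩, G2⟩, _, _⟩, Gi, Gc, _, _, _, _, _⟩, Gi', Gi''⟩, Gc', Gc''⟩ := G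
  obtain rfl : Fo = Go := funext hobj
  obtain rfl : @Fm = @Gm := by
    funext X Y f; exact eq_of_heq (hmap f)
  obtain rfl : @F2 = @G2 := by
    funext X Y f g α; exact eq_of_heq (hmap₂ α)
  obtain rfl : @Fi = @Gi := by
    funext X; exact (Fi'' X).trans (Gi'' X).symm
  obtain rfl : @Fc = @Gc := by
    funext X Y Z f g; exact (Fc'' f g).trans (Gc'' f g).symm
  rfl

theorem strictPseudofunctor_comp_assoc {D : Type*} [Bicategory D] {E : Type*} [Bicategory E]
    (F : StrictPseudofunctor B C) (G : StrictPseudofunctor C D) (H : StrictPseudofunctor D E) :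
    (F.comp G).comp H = F.comp (G.comp H) :=
  strictPseudofunctor_ext (fun _ => rfl) (fun _ => HEq.rfl) (fun _ => HEq.rfl)

end StrictPseudofunctor

/-! ### Extensionality in `Mnd B` and functoriality of `Mnd`. -/

namespace Mnd

variable {B : Type u} [Bicategory.{w, v} B]

theorem ext_of_heq {A A' : Mnd B} (hX : A.X = A'.X) (ht : A.S.t ≍ A'.S.t) (hη : A.S.η ≍ A'.S.η)
    (hμ : A.S.μ ≍ A'.S.μ) : A = A' := by
  obtain ⟨X, t, η, μ, _, _, _⟩ := A
  obtain ⟨X', t', η', μ', _, _, _⟩ := A'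
  obtain rfl : X = X' := hX
  obtain rfl : t = t' := eq_of_heq ht
  obtain rfl : η = η' := eq_of_heq hη
  obtain rfl : μ = μ' := eq_of_heq hμ
  rfl

/-- Two 2-functors to be compared may agree on 0-cells only propositionally, so their values on
1-cells must be compared heterogeneously. -/
theorem hom_heq {A A' C C' : Mnd B} {f : A ⟶ A'} {g : C ⟶ C'} (hA : A = C) (hA' : A' = C')
    (hT : Hom.T f ≍ Hom.T g) (hτ : Hom.τ f ≍ Hom.τ g) : f ≍ g := by
  subst hA hA'
  obtain ⟨T, τ, _⟩ : Hom A A' := f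
  obtain ⟨T', τ', _⟩ : Hom A A' := g
  obtain rfl : T = T' := eq_of_heq hT
  obtain rfl : τ = τ' := eq_of_heq hτ
  rfl

theorem hom₂_heq {A A' C C' : Mnd B} {f g : A ⟶ A'} {f' g' : C ⟶ C'} {α : f ⟶ g} {β : f' ⟶ g'}
    (hA : A = C) (hA' : A' = C') (hf : f ≍ f') (hg : g ≍ g')
    (h : Hom₂.hom α ≍ Hom₂.hom β) : α ≍ β := by
  subst hA hA'
  obtain rfl := eq_of_heq hf
  obtain rfl := eq_of_heq hg
  exact heq_of_eq (hom₂_ext (eq_of_heq h))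

section Map

variable {C : Type u'} [Bicategory.{w', v'} C] [Strict B] [Strict C]

theorem map_comp_forget (F : StrictPseudofunctor B C) :
    (Mnd.map F).comp (Mnd.forget C) = (Mnd.forget B).comp F :=
  strictPseudofunctor_ext (fun _ => rfl) (fun _ => HEq.rfl) (fun _ => HEq.rfl)

/-- Underlying 0-cells, 1-cells and 2-cells agree definitionally. Units, multiplications and the
2-cells `τ` differ only in how the comparison isomorphisms of `F` and `G` are distributed. -/
theorem map_comp {D : Type u''} [Bicategory.{w'', v''} D] [Strict D]
    (F : StrictPseudofunctor B C) (G : StrictPseudofunctor C D) :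
    Mnd.map (F.comp G) = (Mnd.map F).comp (Mnd.map G) := by
  have hobj (A : Mnd B) : (Mnd.map (F.comp G)).obj A = ((Mnd.map F).comp (Mnd.map G)).obj A :=
    ext_of_heq rfl HEq.rfl
      (heq_of_eq (by
        change ((F.comp G).mapId A.X).inv ≫ G.map₂ (F.map₂ A.S.η) =
          (G.mapId _).inv ≫ G.map₂ ((F.mapId _).inv ≫ F.map₂ A.S.η)
        simp
        exact Category.assoc _ _ _))
      (heq_of_eq (by
        change ((F.comp G).mapComp A.S.t A.S.t).inv ≫ G.map₂ (F.map₂ A.S.μ) =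
          (G.mapComp _ _).inv ≫ G.map₂ ((F.mapComp _ _).inv ≫ F.map₂ A.S.μ)
        simp
        exact Category.assoc _ _ _))
  have hmap {A A' : Mnd B} (f : A ⟶ A') :
      (Mnd.map (F.comp G)).map f ≍ ((Mnd.map F).comp (Mnd.map G)).map f :=
    hom_heq (hobj A) (hobj A') HEq.rfl (heq_of_eq (by
      change ((F.comp G).mapComp (Hom.T f) A'.S.t).inv ≫ G.map₂ (F.map₂ (Hom.τ f)) ≫
          ((F.comp G).mapComp A.S.t (Hom.T f)).hom =
        (G.mapComp _ _).inv ≫ G.map₂ ((F.mapComp _ _).inv ≫ F.map₂ (Hom.τ f) ≫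
          (F.mapComp _ _).hom) ≫ (G.mapComp _ _).hom
      simp
      exact Category.assoc _ _ _))
  exact strictPseudofunctor_ext hobj hmap
    (fun {A A' f g} α => hom₂_heq (hobj A) (hobj A') (hmap f) (hmap g) HEq.rfl)

end Map

end Mnd

/-! ### Reflecting and lifting monad structure along a 2-functor. -/

section Reflect

variable {B : Type u} [Bicategory.{w, v} B] {C : Type u'} [Bicategory.{w', v'} C]
  (F : StrictPseudofunctor B C)

/-- This is `isMonadMor_map` run backwards: once the comparison isomorphisms are cancelled, each law
is the image under `F.map₂` of the law sought, and injectivity on 2-cells finishes. -/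
theorem isMonadMor_of_map
    (hF : ∀ {X Y : B} (f g : X ⟶ Y), Function.Injective (fun α : f ⟶ g => F.map₂ α))
    {X X' : B} {S : MonadOn X} {S' : MonadOn X'}
    {T : X ⟶ X'} {τ : T ≫ S'.t ⟶ S.t ≫ T}
    (h : IsMonadMor (S.map F) (S'.map F) (F.map T) (mapCell F τ)) : IsMonadMor S S' T τ where
  unit := by
    have h := h.unit
    change F.map T ◁ ((F.mapId X').inv ≫ F.map₂ S'.η) ≫ mapCell F τ =
      (ρ_ (F.map T)).hom ≫ (λ_ (F.map T)).inv ≫ ((F.mapId X).inv ≫ F.map₂ S.η) ▷ F.map T at h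
    rw [← cancel_epi (F.map T ◁ (F.mapId X').hom), ← cancel_epi (F.mapComp T (𝟙 X')).hom,
      ← cancel_mono (F.mapComp S.t T).inv] at h
    refine hF _ _ ?_
    simpa [mapCell, map₂_lu_inv] using h
  mul := by
    have h := h.mul
    change F.map T ◁ ((F.mapComp S'.t S'.t).inv ≫ F.map₂ S'.μ) ≫ mapCell F τ =
      (α_ (F.map T) (F.map S'.t) (F.map S'.t)).inv ≫ mapCell F τ ▷ F.map S'.t ≫
        (α_ (F.map S.t) (F.map T) (F.map S'.t)).hom ≫ F.map S.t ◁ mapCell F τ ≫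
        (α_ (F.map S.t) (F.map S.t) (F.map T)).inv ≫
        ((F.mapComp S.t S.t).inv ≫ F.map₂ S.μ) ▷ F.map T at h
    rw [← cancel_epi (F.map T ◁ (F.mapComp S'.t S'.t).hom),
      ← cancel_epi (F.mapComp T (S'.t ≫ S'.t)).hom, ← cancel_mono (F.mapComp S.t T).inv] at h
    refine hF _ _ ?_
    simpa [mapCell, map₂_as_inv] using h

theorem isMonadTrans_of_map
    (hF : ∀ {X Y : B} (f g : X ⟶ Y), Function.Injective (fun α : f ⟶ g => F.map₂ α))
    {X X' : B} {s : X ⟶ X} {s' : X' ⟶ X'}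
    {T T' : X ⟶ X'} {τ : T ≫ s' ⟶ s ≫ T} {τ' : T' ≫ s' ⟶ s ≫ T'} {α : T ⟶ T'}
    (h : IsMonadTrans (mapCell F τ) (mapCell F τ') (F.map₂ α)) : IsMonadTrans τ τ' α := by
  refine hF _ _ ?_
  rw [IsMonadTrans, ← cancel_epi (F.mapComp T s').hom, ← cancel_mono (F.mapComp s T').inv] at h
  simpa [mapCell] using h

/-- A 2-functor that is bijective on 2-cells lifts monad structures along 1-cells. -/
theorem exists_monadOn_map
    (hF : ∀ {X Y : B} (f g : X ⟶ Y), Function.Bijective (fun α : f ⟶ g => F.map₂ α))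
    {X : B} (t : X ⟶ X) (S : MonadOn (F.obj X)) (ht : F.map t = S.t) :
    ∃ S' : MonadOn X, S'.map F = S := by
  obtain ⟨t', η, μ, hr, hl, ha⟩ := S
  obtain rfl : F.map t = t' := ht
  obtain ⟨η, rfl⟩ : ∃ η' : 𝟙 X ⟶ t, (F.mapId X).inv ≫ F.map₂ η' = η := by
    obtain ⟨η', h⟩ := (hF (𝟙 X) t).2 ((F.mapId X).hom ≫ η)
    exact ⟨η', (Iso.inv_comp_eq _).2 h⟩
  obtain ⟨μ, rfl⟩ : ∃ μ' : t ≫ t ⟶ t, (F.mapComp t t).inv ≫ F.map₂ μ' = μ := by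
    obtain ⟨μ', h⟩ := (hF (t ≫ t) t).2 ((F.mapComp t t).hom ≫ μ)
    exact ⟨μ', (Iso.inv_comp_eq _).2 h⟩
  -- The given 1-cell, unit and multiplication have been replaced by images under `F`, so only the
  -- three laws remain, and they are reflected by injectivity on 2-cells.
  refine ⟨⟨t, η, μ, (hF _ _).1 ?_, (hF _ _).1 ?_, (hF _ _).1 ?_⟩, rfl⟩
  · simpa [map₂_lu_inv] using hr
  · simpa [map₂_ru_inv] using hl
  · rw [← cancel_epi ((F.mapComp t t).hom ▷ F.map t),
      ← cancel_epi (F.mapComp (t ≫ t) t).hom] at ha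
    simpa using ha

/-- A 2-functor that is surjective on 0-cells, on 1-cells and on 2-cells. -/
structure IsSurjectiveTwoFunctor : Prop where
  obj : Function.Surjective F.obj
  map : ∀ X Y : B, Function.Surjective (fun f : X ⟶ Y => F.map f)
  map₂ : ∀ (X Y : B) (f g : X ⟶ Y), Function.Surjective (fun α : f ⟶ g => F.map₂ α)

variable {F}

theorem IsSurjectiveTwoFunctor.comp {D : Type u''} [Bicategory.{w'', v''} D]
    {G : StrictPseudofunctor C D}
    (hF : IsSurjectiveTwoFunctor F) (hG : IsSurjectiveTwoFunctor G) :
    IsSurjectiveTwoFunctor (F.comp G) where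
  obj := hG.obj.comp hF.obj
  map X Y := (hG.map _ _).comp (hF.map X Y)
  map₂ X Y f g := (hG.map₂ _ _ _ _).comp (hF.map₂ X Y f g)

/-- Surjectivity of `F` lifts the data; injectivity on 2-cells is what makes the lifted data satisfy
the monad, morphism and transformation laws. This is why surjectivity of `F` alone is not assumed.
-/
theorem IsIsoTwoFunctor.surjective_mndMap [Strict B] [Strict C] (hF : IsIsoTwoFunctor F) :
    IsSurjectiveTwoFunctor (Mnd.map F) where
  obj A := by
    obtain ⟨Y, S⟩ := A
    obtain ⟨X, rfl⟩ := hF.bijective_obj.2 Y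
    obtain ⟨t, ht⟩ := (hF.bijective_map X X).2 S.t
    obtain ⟨S', rfl⟩ := exists_monadOn_map F (fun f g => hF.bijective_map₂ _ _ f g) t S ht
    exact ⟨⟨X, S'⟩, rfl⟩
  map A A' f := by
    obtain ⟨T', τ', hτ⟩ : Mnd.Hom ((Mnd.map F).obj A) ((Mnd.map F).obj A') := f
    obtain ⟨T, rfl⟩ := (hF.bijective_map A.X A'.X).2 T'
    obtain ⟨τ, rfl⟩ : ∃ τ : T ≫ A'.S.t ⟶ A.S.t ≫ T, mapCell F τ = τ' := by
      obtain ⟨τ, h⟩ := (hF.bijective_map₂ _ _ (T ≫ A'.S.t) (A.S.t ≫ T)).2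
        ((F.mapComp T A'.S.t).hom ≫ τ' ≫ (F.mapComp A.S.t T).inv)
      refine ⟨τ, ?_⟩
      dsimp only at h
      simp [mapCell, h]
      exact (Category.assoc _ _ _).trans
        ((congrArg (τ' ≫ ·) (Iso.inv_hom_id _)).trans (Category.comp_id _))
    exact ⟨⟨T, τ, isMonadMor_of_map F (fun f g => (hF.bijective_map₂ _ _ f g).1) hτ⟩, rfl⟩
  map₂ A A' f g α := by
    obtain ⟨α', hα⟩ : Mnd.Hom₂ ((Mnd.map F).map f) ((Mnd.map F).map g) := α
    obtain ⟨α, rfl⟩ := (hF.bijective_map₂ _ _ (Mnd.Hom.T f) (Mnd.Hom.T g)).2 α'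
    exact ⟨⟨α, isMonadTrans_of_map F (fun f g => (hF.bijective_map₂ _ _ f g).1) hα⟩, rfl⟩

end Reflect

/-! ### Extending families by a last index. -/

/-- The existential form lets `f` and `a` be substituted by the restrictions of `g`; dependent data
built on them then needs no transport. -/
theorem exists_fin_snoc {n : ℕ} {P : Fin (n + 1) → Sort*} (f : ∀ i : Fin n, P i.castSucc)
    (a : P (Fin.last n)) :
    ∃ g : ∀ i, P i, (fun i : Fin n => g i.castSucc) = f ∧ g (Fin.last n) = a :=
  ⟨Fin.lastCases a f, by simp, by simp⟩

theorem exists_fin_snoc_lt {n : ℕ} {P : Fin (n + 1) → Fin (n + 1) → Sort*}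
    (l : ∀ i j : Fin n, i < j → P i.castSucc j.castSucc)
    (τ : ∀ i : Fin n, P i.castSucc (Fin.last n)) :
    ∃ g : ∀ i j : Fin (n + 1), i < j → P i j,
      (fun (i j : Fin n) (h : i < j) =>
        g i.castSucc j.castSucc (Fin.castSucc_lt_castSucc_iff.2 h)) = l ∧
      (fun i : Fin n => g i.castSucc (Fin.last n) (Fin.castSucc_lt_last i)) = τ := by
  obtain ⟨g, hg, hg'⟩ := exists_fin_snoc
    (P := fun j : Fin (n + 1) => ∀ i, i < j → P i j)
    -- In a pair `i < j` only `j` can be the last index, so the branches with `i` last are vacuous.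
    (fun j i h => (Fin.lastCases (motive := fun i => i < j.castSucc → P i j.castSucc)
      (fun h => absurd h (Fin.le_last _).not_gt)
      (fun i h => l i j (Fin.castSucc_lt_castSucc_iff.1 h)) i) h)
    (fun i h => (Fin.lastCases (motive := fun i => i < Fin.last n → P i (Fin.last n))
      (fun h => absurd h (lt_irrefl _)) (fun i _ => τ i) i) h)
  refine ⟨fun i j h => g j i h, ?_, ?_⟩
  · funext i j h
    dsimp only
    rw [congrFun hg j]
    simp
  · funext i
    dsimp only
    rw [hg']
    simp

theorem hexagon_of_isMonadTrans {B : Type u} [Bicategory.{w, v} B] {X X' : B} {r s : X ⟶ X}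
    {r' s' : X' ⟶ X'} {T : X ⟶ X'} {l : s ≫ r ⟶ r ≫ s} {l' : s' ≫ r' ⟶ r' ≫ s'}
    {ρ : T ≫ r' ⟶ r ≫ T} {σ : T ≫ s' ⟶ s ≫ T}
    (h : IsMonadTrans (compCell ρ l') (compCell l ρ) σ) : Hexagon l l' ρ σ := by
  simp only [IsMonadTrans, compCell, Category.assoc] at h
  simp only [Hexagon, h, Iso.inv_hom_id_assoc]

/-! ### A series of `n + 1` monads as a monad on a series of `n` monads. -/

namespace DistSeries

variable {B : Type u} [Bicategory.{w, v} B] {n : ℕ}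

/-- The 2-functor `(X, S, l) ↦ X`, `(T, τ) ↦ T`, `α ↦ α`. -/
def forget (B : Type u) [Bicategory.{w, v} B] (n : ℕ) :
    StrictPseudofunctor (DistSeries B n) B :=
  StrictPseudofunctor.mk' { obj A := A.X, map f := Hom.T f, map₂ α := Hom₂.hom α }

section Restrict

/-- Drop the last monad of a distributive series. -/
def restrictObj (A : DistSeries B (n + 1)) : DistSeries B n where
  X := A.X
  S i := A.S i.castSucc
  l i j h := A.l i.castSucc j.castSucc (Fin.castSucc_lt_castSucc_iff.2 h)
  isDistLaw _ _ _ := A.isDistLaw _ _ _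
  yangBaxter _ _ _ _ _ := A.yangBaxter _ _ _ _ _

/-- Drop the last 2-cell of a 1-cell of distributive series. -/
def restrictHom {A A' : DistSeries B (n + 1)} (f : A ⟶ A') :
    restrictObj A ⟶ restrictObj A' :=
  Hom.mk (A := restrictObj A) (A' := restrictObj A') f.T (fun i => f.τ i.castSucc)
    (fun _ => f.isMor _) (fun _ _ _ => f.hexagon _ _ _)

/-- The restriction of a 2-cell of distributive series. -/
def restrictHom₂ {A A' : DistSeries B (n + 1)} {f g : A ⟶ A'} (α : f ⟶ g) :
    restrictHom f ⟶ restrictHom g :=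
  Hom₂.mk (f := restrictHom f) (g := restrictHom g) α.hom (fun _ => α.isTrans _)

variable (B n)

/-- The 2-functor dropping the last monad of a distributive series. -/
def restrict : StrictPseudofunctor (DistSeries B (n + 1)) (DistSeries B n) :=
  StrictPseudofunctor.mk' {
    obj A := restrictObj A
    map f := restrictHom f
    map₂ α := restrictHom₂ α
    map₂_id _ := rfl
    map₂_comp _ _ := rfl
    map_id _ := rfl
    map_comp _ _ := rfl
    map₂_whisker_left _ _ _ _ := ((Category.id_comp _).trans (Category.comp_id _)).symm
    map₂_whisker_right _ _ := ((Category.id_comp _).trans (Category.comp_id _)).symm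
    map₂_left_unitor _ := (Category.id_comp _).symm
    map₂_right_unitor _ := (Category.id_comp _).symm
    map₂_associator _ _ _ := ((Category.id_comp _).trans (Category.comp_id _)).symm }

end Restrict

section ToMnd

/-- A monad on the base 0-cell of a distributive series, with distributive laws satisfying the
Yang-Baxter equations, as a monad in the 2-category of distributive series. -/
def liftMonad (A : DistSeries B n) (S : MonadOn A.X)
    (τ : ∀ i, S.t ≫ (A.S i).t ⟶ (A.S i).t ≫ S.t)
    (hτ : ∀ i, IsDistLaw (A.S i) S (τ i))
    (hex : ∀ (i j : Fin n) (h : i < j), Hexagon (A.l i j h) (A.l i j h) (τ i) (τ j)) :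
    MonadOn A where
  t := Hom.mk S.t τ (fun i => ⟨(hτ i).unit_S, (hτ i).mul_S⟩) hex
  η := mkHom₂ S.η (fun i => by simpa [IsMonadTrans, idCell] using (hτ i).unit_T)
  μ := mkHom₂ S.μ (fun i => by simpa [IsMonadTrans, compCell] using (hτ i).mul_T)
  unit_right := hom₂_ext S.unit_right
  unit_left := hom₂_ext S.unit_left
  assoc := hom₂_ext S.assoc

/-- The last monad of a distributive series, as a monad on the series of the others. -/
def toMndObj (A : DistSeries B (n + 1)) : Mnd (DistSeries B n) :=
  ⟨restrictObj A, liftMonad (restrictObj A) (A.S (Fin.last n))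
    (fun i => A.l i.castSucc (Fin.last n) (Fin.castSucc_lt_last i))
    (fun _ => A.isDistLaw _ _ _)
    -- With `T` the last monad and `l = l'`, `Hexagon` unfolds to `YangBaxter`.
    (fun _ _ h => A.yangBaxter _ _ _ (Fin.castSucc_lt_castSucc_iff.2 h) (Fin.castSucc_lt_last _))⟩

/-- The last 2-cell of a 1-cell of distributive series, as a 2-cell of distributive series. -/
def toMndHom {A A' : DistSeries B (n + 1)} (f : A ⟶ A') : toMndObj A ⟶ toMndObj A' :=
  Mnd.Hom.mk (A := toMndObj A) (A' := toMndObj A') (restrictHom f)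
    (Hom₂.mk (f.τ (Fin.last n))
      (fun i => (f.hexagon i.castSucc (Fin.last n) (Fin.castSucc_lt_last i)).isMonadTrans))
    ⟨hom₂_ext (f.isMor (Fin.last n)).unit, hom₂_ext (f.isMor (Fin.last n)).mul⟩

/-- The monad transformation underlying a 2-cell of distributive series. -/
def toMndHom₂ {A A' : DistSeries B (n + 1)} {f g : A ⟶ A'} (α : f ⟶ g) :
    toMndHom f ⟶ toMndHom g :=
  Mnd.Hom₂.mk (f := toMndHom f) (g := toMndHom g) (restrictHom₂ α)
    (hom₂_ext (α.isTrans (Fin.last n)))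

variable (B n)

/-- The 2-functor exhibiting a distributive series of `n + 1` monads as a monad in the 2-category
of distributive series of `n` monads. -/
def toMnd : StrictPseudofunctor (DistSeries B (n + 1)) (Mnd (DistSeries B n)) :=
  StrictPseudofunctor.mk' {
    obj A := toMndObj A
    map f := toMndHom f
    map₂ α := toMndHom₂ α
    map₂_id _ := rfl
    map₂_comp _ _ := rfl
    map_id _ := rfl
    map_comp _ _ := rfl
    map₂_whisker_left _ _ _ _ := ((Category.id_comp _).trans (Category.comp_id _)).symm
    map₂_whisker_right _ _ := ((Category.id_comp _).trans (Category.comp_id _)).symm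
    map₂_left_unitor _ := (Category.id_comp _).symm
    map₂_right_unitor _ := (Category.id_comp _).symm
    map₂_associator _ _ _ := ((Category.id_comp _).trans (Category.comp_id _)).symm }

theorem toMnd_comp_forget : (toMnd B n).comp (Mnd.forget _) = restrict B n :=
  strictPseudofunctor_ext (fun _ => rfl) (fun _ => HEq.rfl) (fun _ => HEq.rfl)

theorem restrict_comp_forget : (restrict B n).comp (forget B n) = forget B (n + 1) :=
  strictPseudofunctor_ext (fun _ => rfl) (fun _ => HEq.rfl) (fun _ => HEq.rfl)

theorem restrict_comp_proj (i : Fin n) : (restrict B n).comp (proj B i) = proj B i.castSucc :=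
  strictPseudofunctor_ext (fun _ => rfl) (fun _ => HEq.rfl) (fun _ => HEq.rfl)

theorem restrict_comp_pairProj (i j : Fin n) (h : i < j) :
    (restrict B n).comp (pairProj B i j h) =
      pairProj B i.castSucc j.castSucc (Fin.castSucc_lt_castSucc_iff.2 h) :=
  strictPseudofunctor_ext (fun _ => rfl) (fun _ => HEq.rfl) (fun _ => HEq.rfl)

/-- `Mnd.map` composes units, multiplications and 2-cells with comparison isomorphisms; those of
`forget` are identities, so each field differs from the expected one by an identity factor. -/
theorem toMnd_comp_map_forget [Strict B] :
    (toMnd B n).comp (Mnd.map (forget B n)) = proj B (Fin.last n) := by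
  have hobj (A : DistSeries B (n + 1)) :
      ((toMnd B n).comp (Mnd.map (forget B n))).obj A = (proj B (Fin.last n)).obj A :=
    Mnd.ext_of_heq rfl HEq.rfl (heq_of_eq (Category.id_comp _)) (heq_of_eq (Category.id_comp _))
  have hmap {A A' : DistSeries B (n + 1)} (f : A ⟶ A') :
      ((toMnd B n).comp (Mnd.map (forget B n))).map f ≍ (proj B (Fin.last n)).map f :=
    Mnd.hom_heq (hobj A) (hobj A') HEq.rfl
      (heq_of_eq ((Category.id_comp _).trans (Category.comp_id _)))
  exact strictPseudofunctor_ext hobj hmap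
    (fun {A A' f g} α => Mnd.hom₂_heq (hobj A) (hobj A') (hmap f) (hmap g) HEq.rfl)

theorem toMnd_comp_map_proj [Strict B] (i : Fin n) :
    (toMnd B n).comp (Mnd.map (proj B i)) =
      pairProj B i.castSucc (Fin.last n) (Fin.castSucc_lt_last i) := by
  have hobj (A : DistSeries B (n + 1)) :
      ((toMnd B n).comp (Mnd.map (proj B i))).obj A =
        (pairProj B i.castSucc (Fin.last n) (Fin.castSucc_lt_last i)).obj A :=
    Mnd.ext_of_heq rfl HEq.rfl (heq_of_eq (Category.id_comp _)) (heq_of_eq (Category.id_comp _))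
  have hmap {A A' : DistSeries B (n + 1)} (f : A ⟶ A') :
      ((toMnd B n).comp (Mnd.map (proj B i))).map f ≍
        (pairProj B i.castSucc (Fin.last n) (Fin.castSucc_lt_last i)).map f :=
    Mnd.hom_heq (hobj A) (hobj A') HEq.rfl
      (heq_of_eq ((Category.id_comp _).trans (Category.comp_id _)))
  exact strictPseudofunctor_ext hobj hmap
    (fun {A A' f g} α => Mnd.hom₂_heq (hobj A) (hobj A') (hmap f) (hmap g) HEq.rfl)

variable {n}

/-- The four axioms of a distributive law split in two: those for `A.S i` come from the 1-cell of
`M`, those for `S` from its unit and multiplication being 2-cells of series. -/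
theorem exists_eq_liftMonad {A : DistSeries B n} (M : MonadOn A) :
    ∃ (S : MonadOn A.X) (τ : ∀ i, S.t ≫ (A.S i).t ⟶ (A.S i).t ≫ S.t)
      (hτ : ∀ i, IsDistLaw (A.S i) S (τ i))
      (hex : ∀ (i j : Fin n) (h : i < j), Hexagon (A.l i j h) (A.l i j h) (τ i) (τ j)),
      M = liftMonad A S τ hτ hex := by
  obtain ⟨t, η, μ, hr, hl, ha⟩ := M
  obtain ⟨T, τ, hτ, hex⟩ : Hom A A := t
  obtain ⟨η, hη⟩ : Hom₂ _ _ := η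
  obtain ⟨μ, hμ⟩ : Hom₂ _ _ := μ
  refine ⟨⟨T, η, μ, congrArg Hom₂.hom hr, congrArg Hom₂.hom hl, congrArg Hom₂.hom ha⟩, τ,
    fun i => ⟨(hτ i).unit, (hτ i).mul, ?_, ?_⟩, hex, rfl⟩
  · simpa [IsMonadTrans, idCell] using hη i
  · simpa [IsMonadTrans, compCell] using hμ i

theorem toMndObj_surjective : Function.Surjective (toMndObj (B := B) (n := n)) := by
  rintro ⟨⟨X, S, l, hl, hyb⟩, M⟩
  obtain ⟨S', τ, hτ, hex, rfl⟩ := exists_eq_liftMonad B M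
  dsimp only at S' τ hτ hex
  -- From here the old families are literally restrictions of the extended ones, so the preimage
  -- maps to the given monad by `rfl`.
  obtain ⟨S, rfl, rfl⟩ := exists_fin_snoc (P := fun _ => MonadOn X) S S'
  obtain ⟨l, rfl, rfl⟩ := exists_fin_snoc_lt
    (P := fun i j => (S j).t ≫ (S i).t ⟶ (S i).t ≫ (S j).t) l τ
  refine ⟨⟨X, S, l, fun i j h => ?_, fun i j k hij hjk => ?_⟩, rfl⟩
  · obtain ⟨i, rfl⟩ := Fin.exists_castSucc_eq.2 (h.trans_le (Fin.le_last j)).ne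
    induction j using Fin.lastCases with
    | last => exact hτ i
    | cast j => exact hl i j (Fin.castSucc_lt_castSucc_iff.1 h)
  · obtain ⟨j, rfl⟩ := Fin.exists_castSucc_eq.2 (hjk.trans_le (Fin.le_last k)).ne
    obtain ⟨i, rfl⟩ := Fin.exists_castSucc_eq.2 (hij.trans_le (Fin.le_last _)).ne
    induction k using Fin.lastCases with
    | last => exact hex i j (Fin.castSucc_lt_castSucc_iff.1 hij)
    | cast k =>
      exact hyb i j k (Fin.castSucc_lt_castSucc_iff.1 hij) (Fin.castSucc_lt_castSucc_iff.1 hjk)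

variable (n)

/-- The laws at indices below the last come from the underlying cell of series. Those at the last
index come from the monad morphism or transformation laws, and the hexagons with the last index from
`σ` being a 2-cell of series. -/
theorem isSurjectiveTwoFunctor_toMnd : IsSurjectiveTwoFunctor (toMnd B n) where
  obj := toMndObj_surjective B
  map A A' f := by
    obtain ⟨f, σ, hσ'⟩ : Mnd.Hom (toMndObj A) (toMndObj A') := f
    obtain ⟨T, τ, hτ, hex⟩ : Hom (restrictObj A) (restrictObj A') := f
    obtain ⟨σ, hσ⟩ : Hom₂ _ _ := σ
    have hunit := congrArg Hom₂.hom hσ'.unit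
    have hmul := congrArg Hom₂.hom hσ'.mul
    obtain ⟨τ, rfl, rfl⟩ := exists_fin_snoc
      (P := fun i => (show A.X ⟶ A'.X from T) ≫ (A'.S i).t ⟶ (A.S i).t ≫ T) τ σ
    refine ⟨Hom.mk T τ (fun i => ?_) (fun i j h => ?_), rfl⟩
    · induction i using Fin.lastCases with
      | last => exact ⟨hunit, hmul⟩
      | cast i => exact hτ i
    · obtain ⟨i, rfl⟩ := Fin.exists_castSucc_eq.2 (h.trans_le (Fin.le_last j)).ne
      induction j using Fin.lastCases with
      | last => exact hexagon_of_isMonadTrans (hσ i)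
      | cast j => exact hex i j (Fin.castSucc_lt_castSucc_iff.1 h)
  map₂ A A' f g α := by
    obtain ⟨⟨α, hα⟩, hα'⟩ : Mnd.Hom₂ (toMndHom f) (toMndHom g) := α
    refine ⟨Hom₂.mk α (fun i => ?_), rfl⟩
    induction i using Fin.lastCases with
    | last => exact congrArg Hom₂.hom hα'
    | cast i => exact hα i

end ToMnd

end DistSeries

/-! ### Joint injectivity of the projections, and series of one monad. -/

namespace DistSeries

section Injective

variable {B : Type u} [Bicategory.{w, v} B] {n : ℕ}

theorem ext_of_proj {A A' : DistSeries B (n + 1)}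
    (hS : ∀ i, (proj B i).obj A = (proj B i).obj A')
    (hl : ∀ i j h, (pairProj B i j h).obj A = (pairProj B i j h).obj A') : A = A' := by
  obtain ⟨X, S, l, _, _⟩ := A
  obtain ⟨X', S', l', _, _⟩ := A'
  -- The 0-cell is read off from a projection, so at least one monad must be present.
  obtain rfl : X = X' := congrArg Mnd.X (hS 0)
  obtain rfl : S = S' := by
    funext i
    exact eq_of_heq (Mnd.mk.inj (hS i)).2
  obtain rfl : l = l' := by
    funext i j h
    -- The second monad of a pair has 1-cell `(S j, l i j)`, whose 2-cell is the distributive law.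
    have h₁ := eq_of_heq (Mnd.mk.inj (hl i j h)).2
    exact eq_of_heq (Mnd.Hom.mk.inj (congrArg MonadOn.t h₁)).2
  rfl

theorem hom_ext_of_proj {A A' : DistSeries B (n + 1)} {f g : A ⟶ A'}
    (h : ∀ i, (proj B i).map f = (proj B i).map g) : f = g := by
  obtain ⟨T, τ, _, _⟩ : Hom A A' := f
  obtain ⟨T', τ', _, _⟩ : Hom A A' := g
  obtain rfl : T = T' := (Mnd.Hom.mk.inj (h 0)).1
  obtain rfl : τ = τ' := by
    funext i
    exact eq_of_heq (Mnd.Hom.mk.inj (h i)).2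
  rfl

/-- A 2-functor out of `DistSeries B (n + 1)` over `B`, over which all the projections factor, is
an isomorphism as soon as it is surjective. -/
theorem isIsoTwoFunctor_of_comp_eq_proj {C : Type u'} [Bicategory.{w', v'} C]
    {F : StrictPseudofunctor (DistSeries B (n + 1)) C} (hF : IsSurjectiveTwoFunctor F)
    {U : StrictPseudofunctor C B} (hU : F.comp U = forget B (n + 1))
    {P : ∀ _ : Fin (n + 1), StrictPseudofunctor C (Mnd B)} (hP : ∀ i, F.comp (P i) = proj B i)
    {Q : ∀ i j : Fin (n + 1), i < j → StrictPseudofunctor C (Mnd (Mnd B))}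
    (hQ : ∀ i j h, F.comp (Q i j h) = pairProj B i j h) : IsIsoTwoFunctor F where
  bijective_obj := by
    refine ⟨fun A A' e => ext_of_proj (fun i => ?_) (fun i j h => ?_), hF.obj⟩
    · rw [← hP i]; exact congrArg (P i).obj e
    · rw [← hQ i j h]; exact congrArg (Q i j h).obj e
  bijective_map A A' := by
    refine ⟨fun f g e => hom_ext_of_proj (fun i => ?_), hF.map A A'⟩
    rw [← hP i]; exact congrArg (P i).map e
  bijective_map₂ A A' f g := by
    refine ⟨fun α β e => hom₂_ext ?_, hF.map₂ A A' f g⟩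
    change (forget B (n + 1)).map₂ α = (forget B (n + 1)).map₂ β
    rw [← hU]; exact congrArg U.map₂ e

end Injective

theorem isSurjectiveTwoFunctor_proj_one (B : Type u) [Bicategory.{w, v} B] :
    IsSurjectiveTwoFunctor (proj B (0 : Fin 1)) where
  obj A := ⟨⟨A.X, fun _ => A.S, fun i j h => absurd h (by omega),
    fun i j h => absurd h (by omega), fun i j k h => absurd h (by omega)⟩, rfl⟩
  map A A' f := by
    obtain ⟨T, τ, hτ⟩ : Mnd.Hom ((proj B (0 : Fin 1)).obj A) ((proj B (0 : Fin 1)).obj A') := f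
    -- The type of the 2-cell depends on `i`; `Fin.cases` makes its value at `0` reduce to `τ`, so
    -- the projection is `f` by `rfl`.
    refine ⟨Hom.mk T (fun i => Fin.cases τ (fun i => i.elim0) i) (fun i => ?_)
      (fun i j h => absurd h (by omega)), rfl⟩
    obtain rfl := Subsingleton.elim i 0
    exact hτ
  map₂ A A' f g α := by
    obtain ⟨α, hα⟩ : Mnd.Hom₂ ((proj B (0 : Fin 1)).map f) ((proj B (0 : Fin 1)).map g) := α
    refine ⟨Hom₂.mk α (fun i => ?_), rfl⟩
    obtain rfl := Subsingleton.elim i 0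
    exact hα

end DistSeries

/-! ### The comparison with the iterated monad construction. -/

section MndPow

variable (B : TwoCat.{w, v, u}) (k : ℕ)

theorem mndPowProj_last :
    mndPowProj B (k + 1) (Fin.last (k + 1)) = Mnd.map (mndPowBase B k) :=
  Fin.lastCases_last

theorem mndPowProj_castSucc (i : Fin (k + 1)) :
    mndPowProj B (k + 1) i.castSucc = (Mnd.forget (mndPow B k)).comp (mndPowProj B k i) :=
  Fin.lastCases_castSucc i

theorem mndPowPairProj_last (i : Fin (k + 1)) (h : i.castSucc < Fin.last (k + 1)) :
    mndPowPairProj B (k + 1) i.castSucc (Fin.last (k + 1)) h = Mnd.map (mndPowProj B k i) :=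
  dif_pos rfl

theorem mndPowPairProj_castSucc (i j : Fin (k + 1)) (h : i.castSucc < j.castSucc) :
    mndPowPairProj B (k + 1) i.castSucc j.castSucc h =
      (Mnd.forget (mndPow B k)).comp
        (mndPowPairProj B k i j (Fin.castSucc_lt_castSucc_iff.1 h)) :=
  dif_neg (Fin.castSucc_lt_last j).ne

/-- The comparison 2-functor from distributive series of `k + 1` monads to `Mnd^(k+1) B`. -/
def toMndPow (B : TwoCat.{w, v, u}) :
    ∀ k : ℕ, StrictPseudofunctor (DistSeries B (k + 1)) (mndPow B k)
  | 0 => DistSeries.proj B 0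
  | k + 1 => (DistSeries.toMnd B (k + 1)).comp (Mnd.map (toMndPow B k))

theorem toMndPow_comp_forget (k : ℕ) :
    (toMndPow B (k + 1)).comp (Mnd.forget (mndPow B k)) =
      (DistSeries.restrict B (k + 1)).comp (toMndPow B k) := by
  refine (strictPseudofunctor_comp_assoc (DistSeries.toMnd B (k + 1)) (Mnd.map (toMndPow B k))
    (Mnd.forget (mndPow B k))).trans ?_
  rw [Mnd.map_comp_forget, ← strictPseudofunctor_comp_assoc, DistSeries.toMnd_comp_forget]

/-- Any 2-functor of the form `Mnd.map P` on the next stage is thereby reduced to `P` on the current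
one. This applies to the projections involving the last monad, which are `Mnd.map` of the base
2-functor or of a projection. -/
theorem toMndPow_comp_map {D : Type*} [Bicategory D] [Strict D] (k : ℕ)
    (P : StrictPseudofunctor (mndPow B k) D) :
    (toMndPow B (k + 1)).comp (Mnd.map P) =
      (DistSeries.toMnd B (k + 1)).comp (Mnd.map ((toMndPow B k).comp P)) := by
  refine (strictPseudofunctor_comp_assoc (DistSeries.toMnd B (k + 1)) (Mnd.map (toMndPow B k))
    (Mnd.map P)).trans ?_
  rw [← Mnd.map_comp]

theorem toMndPow_comp_mndPowBase :
    (toMndPow B k).comp (mndPowBase B k) = DistSeries.forget B (k + 1) := by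
  induction k with
  | zero => exact strictPseudofunctor_ext (fun _ => rfl) (fun _ => HEq.rfl) (fun _ => HEq.rfl)
  | succ k ih =>
    refine (strictPseudofunctor_comp_assoc (toMndPow B (k + 1)) (Mnd.forget (mndPow B k))
      (mndPowBase B k)).symm.trans ?_
    rw [toMndPow_comp_forget, strictPseudofunctor_comp_assoc, ih,
      DistSeries.restrict_comp_forget]

theorem toMndPow_comp_mndPowProj (i : Fin (k + 1)) :
    (toMndPow B k).comp (mndPowProj B k i) = DistSeries.proj B i := by
  induction k with
  | zero =>
    obtain rfl := Fin.fin_one_eq_zero i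
    exact strictPseudofunctor_ext (fun _ => rfl) (fun _ => HEq.rfl) (fun _ => HEq.rfl)
  | succ k ih =>
    induction i using Fin.lastCases with
    | last =>
      rw [mndPowProj_last]
      refine (toMndPow_comp_map B k _).trans ?_
      rw [toMndPow_comp_mndPowBase, DistSeries.toMnd_comp_map_forget]
    | cast i =>
      rw [mndPowProj_castSucc]
      refine (strictPseudofunctor_comp_assoc _ _ _).symm.trans ?_
      rw [toMndPow_comp_forget, strictPseudofunctor_comp_assoc, ih,
        DistSeries.restrict_comp_proj]

theorem toMndPow_comp_mndPowPairProj (i j : Fin (k + 1)) (h : i < j) :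
    (toMndPow B k).comp (mndPowPairProj B k i j h) = DistSeries.pairProj B i j h := by
  induction k with
  | zero => exact absurd h (by omega)
  | succ k ih =>
    obtain ⟨i, rfl⟩ := Fin.exists_castSucc_eq.2 (h.trans_le (Fin.le_last j)).ne
    induction j using Fin.lastCases with
    | last =>
      rw [mndPowPairProj_last]
      refine (toMndPow_comp_map B k _).trans ?_
      rw [toMndPow_comp_mndPowProj, DistSeries.toMnd_comp_map_proj]
    | cast j =>
      rw [mndPowPairProj_castSucc]
      refine (strictPseudofunctor_comp_assoc _ _ _).symm.trans ?_
      rw [toMndPow_comp_forget, strictPseudofunctor_comp_assoc, ih,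
        DistSeries.restrict_comp_pairProj]

theorem isIsoTwoFunctor_toMndPow : IsIsoTwoFunctor (toMndPow B k) := by
  refine DistSeries.isIsoTwoFunctor_of_comp_eq_proj ?_ (toMndPow_comp_mndPowBase B k)
    (toMndPow_comp_mndPowProj B k) (toMndPow_comp_mndPowPairProj B k)
  induction k with
  | zero => exact DistSeries.isSurjectiveTwoFunctor_proj_one B
  | succ k ih =>
    -- The inductive hypothesis is only surjectivity; the projections upgrade it to an isomorphism,
    -- as `surjective_mndMap` requires.
    have hk : IsIsoTwoFunctor (toMndPow B k) :=
      DistSeries.isIsoTwoFunctor_of_comp_eq_proj ih (toMndPow_comp_mndPowBase B k)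
        (toMndPow_comp_mndPowProj B k) (toMndPow_comp_mndPowPairProj B k)
    exact (DistSeries.isSurjectiveTwoFunctor_toMnd B (k + 1)).comp hk.surjective_mndMap

end MndPow

end FormalMonads

theorem mainTheorem2 (B : FormalMonads.TwoCat.{w, v, u}) (k : ℕ)
    (hn : 3 ≤ k + 1) :
    ∃ F : StrictPseudofunctor (FormalMonads.DistSeries B (k + 1)) (FormalMonads.mndPow B k),
      FormalMonads.IsIsoTwoFunctor F ∧
      (∀ i : Fin (k + 1),
        F.comp (FormalMonads.mndPowProj B k i) = FormalMonads.DistSeries.proj B i) ∧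
      (∀ (i j : Fin (k + 1)) (h : i < j),
        F.comp (FormalMonads.mndPowPairProj B k i j h) =
          FormalMonads.DistSeries.pairProj B i j h) :=
  ⟨FormalMonads.toMndPow B k, FormalMonads.isIsoTwoFunctor_toMndPow B k,
    FormalMonads.toMndPow_comp_mndPowProj B k, FormalMonads.toMndPow_comp_mndPowPairProj B k⟩
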